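/- Work in the Euclidean plane $\mathbb{R}^2$. For $0<\delta\le 1$, a $\delta$-ball is a closed ball of radius $\delta$, and a $\delta$-tube is a closed $\delta\times 1$ rectangle (in any position and orientation). Two $\delta$-tubes $s,t$ are essentially distinct if $|s\cap t|\le \tfrac12|t|$, where $|\cdot|$ is the area. For $0\le\beta\le 2$ and $K\ge 1$, a finite set $P$ of $\delta$-balls contained in $[0,1]^2$ is a $(\delta,\beta,K)$-set of balls if for every $w\in[\delta,1]$ and every ball $B_w$ of radius $w$, $$\#\{p\in P : p\subset B_w\}\le K\,(w/\delta)^\beta .$$ For $0\le\alpha\le 2$ and $K\ge 1$, a finite set $\mathbb{T}$ of pairwise essentially distinct $\delta$-tubes contained in $[0,1]^2$ is a $(\delta,\alpha,K)$-set of tubes if for every $w\in[\delta,1]$ and every $w\times 2$ rectangle $T_w$, $$\#\{t\in\mathbb{T} : t\subset T_w\}\le K\,(w/\delta)^\alpha .$$ **Theorem 5.2.** For every $\varepsilon>0$ there is a constant $C_\varepsilon>0$, depending only on $\varepsilon$, such that the following holds for all $\alpha,\beta\in[0,2]$, all $K_\alpha,K_\beta\ge 1$ and all $0<\delta\le 1$.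 Let $\mathbb{T}$ be a $(\delta,\alpha,K_\alpha)$-set of tubes, and for every $t\in\mathbb{T}$ let $P_t$ be a $(\delta,\beta,K_\beta)$-set of balls each of which intersects $t$. Put $P=\bigcup_{t\in\mathbb{T}}P_t$, $D=\delta^{-1}$ and $c=\max(\alpha+\beta,2)^{-1}$. Then $$\sum_{t\in\mathbb{T}}|P_t|\;\le\; C_\varepsilon\, D^{c+\varepsilon}\,K_\beta^{c}\,K_\alpha^{c}\,|P|^{1-c}\,|\mathbb{T}|^{1-c},$$ where $|P_t|$, $|P|$, $|\mathbb{T}|$ denote numbers of elements. -/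

import Mathlib

/-- The Euclidean plane. -/
abbrev Plane : Type := EuclideanSpace ℝ (Fin 2)

/-- The closed unit square `[0,1]²`. -/
def unitSquare : Set Plane := {x | ∀ i, 0 ≤ x i ∧ x i ≤ 1}

/-- `p` is a (closed) ball of radius `r`. -/
def IsBallOfRadius (r : ℝ) (p : Set Plane) : Prop :=
  ∃ x : Plane, p = Metric.closedBall x r

/-- The closed rectangle with centre `x`, with side of length `l` in the direction of the unit
vector `u` and side of length `w` in the direction of the unit vector `(-u 1, u 0)`,
which is orthogonal to `u`. -/
def rectangle (x u : Plane) (w l : ℝ) : Set Plane :=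
  {y | |u 0 * (y 0 - x 0) + u 1 * (y 1 - x 1)| ≤ l / 2 ∧
    |u 0 * (y 1 - x 1) - u 1 * (y 0 - x 0)| ≤ w / 2}

/-- `R` is a `w × l` rectangle in the plane (any position, any orientation). -/
def IsRectangle (w l : ℝ) (R : Set Plane) : Prop :=
  ∃ x u : Plane, ‖u‖ = 1 ∧ R = rectangle x u w l

/-- A `δ`-tube is a `δ × 1` rectangle. -/
def IsTube (δ : ℝ) (t : Set Plane) : Prop := IsRectangle δ 1 t

/-- Two tubes of the same dimensions are essentially distinct if at most half of the area of each
of them lies in the other. -/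
def EssentiallyDistinct (s t : Set Plane) : Prop :=
  MeasureTheory.volume (s ∩ t) ≤ MeasureTheory.volume s / 2 ∧
    MeasureTheory.volume (s ∩ t) ≤ MeasureTheory.volume t / 2

/-- `P` is a `(δ, β, K)`-set of balls. -/
structure IsBallSet (δ β K : ℝ) (P : Finset (Set Plane)) : Prop where
  isBall : ∀ p ∈ P, IsBallOfRadius δ p
  subset_unitSquare : ∀ p ∈ P, p ⊆ unitSquare
  card_le : ∀ w : ℝ, δ ≤ w → w ≤ 1 → ∀ B : Set Plane, IsBallOfRadius w B →
    ({p | p ∈ P ∧ p ⊆ B}.ncard : ℝ) ≤ K * (w / δ) ^ β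

/-- `T` is a `(δ, α, K)`-set of tubes. -/
structure IsTubeSet (δ α K : ℝ) (T : Finset (Set Plane)) : Prop where
  isTube : ∀ t ∈ T, IsTube δ t
  subset_unitSquare : ∀ t ∈ T, t ⊆ unitSquare
  essentiallyDistinct : ∀ s ∈ T, ∀ t ∈ T, s ≠ t → EssentiallyDistinct s t
  card_le : ∀ w : ℝ, δ ≤ w → w ≤ 1 → ∀ R : Set Plane, IsRectangle w 2 R →
    ({t | t ∈ T ∧ t ⊆ R}.ncard : ℝ) ≤ K * (w / δ) ^ α

open MeasureTheory

/-- The cutoff function, equal to `1` for `‖x‖ ≤ 4` and to `0` for `5 ≤ ‖x‖`. -/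
noncomputable def cutoff (x : ℝ × ℝ) : ℝ := max 0 (min 1 (5 - ‖x‖))

lemma cutoff_nonneg (x : ℝ × ℝ) : 0 ≤ cutoff x := le_max_left _ _

lemma cutoff_le_one (x : ℝ × ℝ) : cutoff x ≤ 1 := by simp [cutoff]

lemma cutoff_eq_one {x : ℝ × ℝ} (h : ‖x‖ ≤ 4) : cutoff x = 1 := by
  rw [cutoff, min_eq_left (by linarith), max_eq_right (by norm_num)]

lemma cutoff_eq_zero {x : ℝ × ℝ} (h : 5 ≤ ‖x‖) : cutoff x = 0 := by
  rw [cutoff, max_eq_left]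
  exact (min_le_right _ _).trans (by linarith)

lemma continuous_cutoff : Continuous cutoff := by
  unfold cutoff; fun_prop

lemma abs_cutoff_sub_le (x y : ℝ × ℝ) : |cutoff x - cutoff y| ≤ ‖x - y‖ := by
  have h1 := abs_norm_sub_norm_le x y
  have h2 : |cutoff x - cutoff y| ≤ |min 1 (5 - ‖x‖) - min 1 (5 - ‖y‖)| := by
    unfold cutoff
    simpa using abs_max_sub_max_le_abs (min 1 (5 - ‖x‖)) (min 1 (5 - ‖y‖)) 0 |>.trans' (by
      rw [max_comm 0, max_comm 0])
  have h3 : |min 1 (5 - ‖x‖) - min 1 (5 - ‖y‖)| ≤ |(5 - ‖x‖) - (5 - ‖y‖)| := by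
    have := abs_min_sub_min_le_max 1 (5 - ‖x‖) 1 (5 - ‖y‖)
    simpa using this
  have h4 : (5 - ‖x‖) - (5 - ‖y‖) = -(‖x‖ - ‖y‖) := by ring
  rw [h4, abs_neg] at h3
  linarith

/-- The affine form `x ↦ a x₁ + b x₂ - c` attached to `(a, b, c)`. -/
def lineForm (l : ℝ × ℝ × ℝ) (x : ℝ × ℝ) : ℝ := l.1 * x.1 + l.2.1 * x.2 - l.2.2

/-- The determinant of the linear parts of two affine forms. -/
def formDet (l l' : ℝ × ℝ × ℝ) : ℝ := l.1 * l'.2.1 - l.2.1 * l'.1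

lemma continuous_lineForm (l : ℝ × ℝ × ℝ) : Continuous (lineForm l) := by
  unfold lineForm; fun_prop

lemma map_two_forms {a b c d : ℝ} (h : a * d - b * c ≠ 0) :
    Measure.map (fun x : ℝ × ℝ => (a * x.1 + b * x.2, c * x.1 + d * x.2)) volume
      = ENNReal.ofReal |a * d - b * c|⁻¹ • (volume : Measure (ℝ × ℝ)) := by
  set f : ℝ × ℝ →ₗ[ℝ] ℝ × ℝ :=
    Matrix.toLin (Module.Basis.finTwoProd ℝ) (Module.Basis.finTwoProd ℝ) !![a, b; c, d] with hf
  have hdet : LinearMap.det f = a * d - b * c := by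
    rw [hf, LinearMap.det_toLin, Matrix.det_fin_two_of]
  have happ : (fun x : ℝ × ℝ => (a * x.1 + b * x.2, c * x.1 + d * x.2)) = f :=
    funext fun x => (Matrix.toLin_finTwoProd_apply a b c d x).symm
  rw [happ, Measure.map_linearMap_addHaar_eq_smul_addHaar (volume : Measure (ℝ × ℝ))
    (f := f) (by rwa [hdet]), hdet, abs_inv]

/-- Linear change of variables in the plane. -/
lemma integral_comp_two_forms {a b c d : ℝ} (h : a * d - b * c ≠ 0) {F : ℝ × ℝ → ℝ}
    (hF : Measurable F) :
    ∫ x : ℝ × ℝ, F (a * x.1 + b * x.2, c * x.1 + d * x.2) = |a * d - b * c|⁻¹ * ∫ y, F y := by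
  rw [← integral_map (φ := fun x : ℝ × ℝ => (a * x.1 + b * x.2, c * x.1 + d * x.2))
    (by fun_prop) hF.aestronglyMeasurable, map_two_forms h, integral_smul_measure,
    ENNReal.toReal_ofReal (by positivity), smul_eq_mul]

lemma integrable_comp_two_forms {a b c d : ℝ} (h : a * d - b * c ≠ 0) {F : ℝ × ℝ → ℝ}
    (hF : Integrable F) :
    Integrable fun x : ℝ × ℝ => F (a * x.1 + b * x.2, c * x.1 + d * x.2) := by
  have hm : Integrable F
      (Measure.map (fun x : ℝ × ℝ => (a * x.1 + b * x.2, c * x.1 + d * x.2)) volume) := by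
    rw [map_two_forms h]
    exact hF.smul_measure ENNReal.ofReal_ne_top
  exact hm.comp_measurable (by fun_prop)

/-- A profile: bounded by one, supported in `[-M, M]`, with vanishing integral. -/
structure IsProfile (M : ℝ) (ψ : ℝ → ℝ) : Prop where
  measurable : Measurable ψ
  abs_le_one : ∀ u, |ψ u| ≤ 1
  eq_zero : ∀ u, M < |u| → ψ u = 0
  integral_eq_zero : ∫ u, ψ u = 0

/-- The weighted inner product of the profiles around two lines. -/
noncomputable def crossTerm (ψ : ℝ → ℝ) (l l' : ℝ × ℝ × ℝ) : ℝ :=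
  ∫ x, ψ (lineForm l x) * ψ (lineForm l' x) * cutoff x

lemma IsProfile.abs_le_indicator {M : ℝ} {ψ : ℝ → ℝ} (hψ : IsProfile M ψ) (u : ℝ) :
    |ψ u| ≤ (Set.Icc (-M) M).indicator 1 u := by
  by_cases h : u ∈ Set.Icc (-M) M
  · simpa [h] using hψ.abs_le_one u
  · rw [hψ.eq_zero u, Set.indicator_of_notMem h, abs_zero]
    by_contra h'
    exact h (abs_le.1 (not_lt.1 h'))

lemma integrable_of_bounded_box {F : ℝ × ℝ → ℝ} (hF : Measurable F) {A B : Set ℝ} {K : ℝ}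
    (hA : MeasurableSet A) (hB : MeasurableSet B) (hA' : volume A ≠ ⊤) (hB' : volume B ≠ ⊤)
    (h : ∀ x, |F x| ≤ (A ×ˢ B).indicator (fun _ => K) x) : Integrable F := by
  refine Integrable.mono' (g := (A ×ˢ B).indicator (fun _ => K)) ?_ hF.aestronglyMeasurable
    (Filter.Eventually.of_forall h)
  rw [integrable_indicator_iff (hA.prod hB)]
  refine integrableOn_const ?_
  rw [Measure.volume_eq_prod, Measure.prod_prod]
  exact ENNReal.mul_ne_top hA' hB'

lemma cutoff_le_indicator (x : ℝ × ℝ) :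
    cutoff x ≤ (Set.Icc (-5 : ℝ) 5 ×ˢ Set.Icc (-5 : ℝ) 5).indicator (fun _ => (1 : ℝ)) x := by
  by_cases h : x ∈ Set.Icc (-5 : ℝ) 5 ×ˢ Set.Icc (-5 : ℝ) 5
  · rw [Set.indicator_of_mem h]
    exact cutoff_le_one x
  · rw [Set.indicator_of_notMem h, cutoff_eq_zero]
    by_contra h'
    rw [not_le, Prod.norm_def, max_lt_iff, Real.norm_eq_abs, Real.norm_eq_abs] at h'
    exact h ⟨abs_le.1 h'.1.le, abs_le.1 h'.2.le⟩

lemma IsProfile.integrable_cross {M : ℝ} {ψ : ℝ → ℝ} (hψ : IsProfile M ψ)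
    (l l' : ℝ × ℝ × ℝ) :
    Integrable fun x => ψ (lineForm l x) * ψ (lineForm l' x) * cutoff x := by
  refine integrable_of_bounded_box (A := Set.Icc (-5) 5) (B := Set.Icc (-5) 5) (K := 1)
    (((hψ.measurable.comp (continuous_lineForm l).measurable).mul
      (hψ.measurable.comp (continuous_lineForm l').measurable)).mul continuous_cutoff.measurable)
    measurableSet_Icc measurableSet_Icc (by simp) (by simp) fun x => ?_
  refine le_trans ?_ (cutoff_le_indicator x)
  rw [abs_mul, abs_mul, abs_of_nonneg (cutoff_nonneg x)]
  exact mul_le_of_le_one_left (cutoff_nonneg x)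
    (mul_le_one₀ (hψ.abs_le_one _) (abs_nonneg _) (hψ.abs_le_one _))

lemma cross_eq_zero {M : ℝ} {ψ : ℝ → ℝ} (hψ : IsProfile M ψ) {l l' : ℝ × ℝ × ℝ}
    (h : ¬ ∃ x : ℝ × ℝ, ‖x‖ ≤ 5 ∧ |lineForm l x| ≤ M ∧ |lineForm l' x| ≤ M) :
    crossTerm ψ l l' = 0 := by
  have : ∀ x, ψ (lineForm l x) * ψ (lineForm l' x) * cutoff x = 0 := by
    intro x
    by_contra h0
    apply h
    refine ⟨x, ?_, ?_, ?_⟩ <;> by_contra h1 <;> apply h0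
    · rw [cutoff_eq_zero (not_le.1 h1).le, mul_zero]
    · rw [hψ.eq_zero _ (not_le.1 h1), zero_mul, zero_mul]
    · rw [hψ.eq_zero (lineForm l' x) (not_le.1 h1), mul_zero, zero_mul]
  simp [crossTerm, this]

lemma integral_box_indicator (p q r s : ℝ) (h1 : p ≤ q) (h2 : r ≤ s) :
    ∫ x : ℝ × ℝ, (Set.Icc p q ×ˢ Set.Icc r s).indicator (fun _ => (1 : ℝ)) x
      = (q - p) * (s - r) := by
  rw [integral_indicator (measurableSet_Icc.prod measurableSet_Icc), setIntegral_const,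
    Measure.volume_eq_prod, measureReal_prod_prod]
  simp [h1, h2]

lemma integrable_cutoff : Integrable cutoff := by
  refine integrable_of_bounded_box (A := Set.Icc (-5) 5) (B := Set.Icc (-5) 5) (K := 1)
    continuous_cutoff.measurable measurableSet_Icc measurableSet_Icc (by simp) (by simp)
    fun x => ?_
  rw [abs_of_nonneg (cutoff_nonneg x)]
  exact cutoff_le_indicator x

lemma integral_cutoff_le : ∫ x, cutoff x ≤ 100 := by
  have hm : Measurable ((Set.Icc (-5 : ℝ) 5 ×ˢ Set.Icc (-5 : ℝ) 5).indicator fun _ => (1 : ℝ)) :=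
    measurable_const.indicator (measurableSet_Icc.prod measurableSet_Icc)
  have h := integral_mono integrable_cutoff
    (integrable_of_bounded_box hm measurableSet_Icc measurableSet_Icc (by simp) (by simp)
      fun x => (abs_of_nonneg (Set.indicator_nonneg (by simp) x)).le) cutoff_le_indicator
  rw [integral_box_indicator _ _ _ _ (by norm_num) (by norm_num)] at h
  norm_num at h
  exact h

/-- The area of the part of a strip inside the square of side `10`. -/
lemma integral_strip_le {M : ℝ} (hM : 0 ≤ M) {l : ℝ × ℝ × ℝ} (hl : l.1 ^ 2 + l.2.1 ^ 2 = 1)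
    {F : ℝ × ℝ → ℝ} (h0 : ∀ x, 5 ≤ ‖x‖ → F x = 0) (h1 : ∀ x, |F x| ≤ 1)
    (h2 : ∀ x, M < |lineForm l x| → F x = 0) : |∫ x, F x| ≤ 40 * M := by
  have key : ∀ (a b c d : ℝ), 1 / 2 ≤ |a * d - b * c| →
      (∀ x : ℝ × ℝ, |F x| ≤ (Set.Icc (l.2.2 - M) (l.2.2 + M) ×ˢ Set.Icc (-5 : ℝ) 5).indicator
        (fun _ => (1 : ℝ)) (a * x.1 + b * x.2, c * x.1 + d * x.2)) →
      |∫ x, F x| ≤ 40 * M := by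
    intro a b c d hd hF
    set G := (Set.Icc (l.2.2 - M) (l.2.2 + M) ×ˢ Set.Icc (-5 : ℝ) 5).indicator
        (fun _ => (1 : ℝ)) with hG
    have hGm : Measurable G :=
      measurable_const.indicator (measurableSet_Icc.prod measurableSet_Icc)
    have hne : a * d - b * c ≠ 0 := by
      intro h; rw [h] at hd; norm_num at hd
    have e := integral_comp_two_forms hne hGm
    have e' : ∫ y, G y = 20 * M := by
      rw [hG, integral_box_indicator _ _ _ _ (by linarith) (by norm_num)]; ring
    have hinv : |a * d - b * c|⁻¹ ≤ 2 := by
      rw [inv_le_comm₀ (by linarith) (by norm_num)]; linarith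
    have hint : ∫ x : ℝ × ℝ, G (a * x.1 + b * x.2, c * x.1 + d * x.2) ≤ 40 * M := by
      rw [e, e']; nlinarith
    have hGi : Integrable G := by
      refine integrable_of_bounded_box hGm (A := Set.Icc (l.2.2 - M) (l.2.2 + M))
        (B := Set.Icc (-5 : ℝ) 5) (K := 1) measurableSet_Icc measurableSet_Icc
        (by simp) (by simp) fun x => ?_
      rw [abs_of_nonneg (Set.indicator_nonneg (by simp) _)]
    exact (norm_integral_le_of_norm_le (integrable_comp_two_forms hne hGi)
      (Filter.Eventually.of_forall fun x => by
        rw [Real.norm_eq_abs]; exact hF x)).trans hint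
  have hbox : ∀ x : ℝ × ℝ, F x ≠ 0 → |x.1| ≤ 5 ∧ |x.2| ≤ 5 ∧ |lineForm l x| ≤ M := by
    intro x hx
    have hx5 : ‖x‖ < 5 := not_le.1 fun h => hx (h0 x h)
    rw [Prod.norm_def, max_lt_iff, Real.norm_eq_abs, Real.norm_eq_abs] at hx5
    exact ⟨hx5.1.le, hx5.2.le, not_lt.1 fun h => hx (h2 x h)⟩
  have main : ∀ c d : ℝ, (∀ x : ℝ × ℝ, |x.1| ≤ 5 → |x.2| ≤ 5 → |c * x.1 + d * x.2| ≤ 5) →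
      1 / 2 ≤ |l.1 * d - l.2.1 * c| → |∫ x, F x| ≤ 40 * M := by
    intro c d hcd hdet
    refine key l.1 l.2.1 c d hdet fun x => ?_
    by_cases hx : F x = 0
    · rw [hx, abs_zero]; exact Set.indicator_nonneg (by simp) _
    · obtain ⟨hx1, hx2, hx3⟩ := hbox x hx
      rw [Set.indicator_of_mem]
      · exact h1 x
      · have := abs_le.1 hx3
        unfold lineForm at this
        exact ⟨⟨by dsimp only; linarith, by dsimp only; linarith⟩, abs_le.1 (hcd x hx1 hx2)⟩
  rcases le_total (1 / 2) |l.1| with h | h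
  · exact main 0 1 (fun x _ hx => by simpa using hx) (by simpa using h)
  · refine main 1 0 (fun x hx _ => by simpa using hx) ?_
    simp only [mul_zero, mul_one, zero_sub, abs_neg]
    by_contra h'
    have h3 := abs_nonneg l.1
    have h4 := abs_nonneg l.2.1
    rw [← sq_abs, ← sq_abs l.2.1] at hl
    nlinarith

lemma abs_crossTerm_le {M : ℝ} (hM : 0 ≤ M) {ψ : ℝ → ℝ} (hψ : IsProfile M ψ)
    {l l' : ℝ × ℝ × ℝ} (hl : l.1 ^ 2 + l.2.1 ^ 2 = 1) : |crossTerm ψ l l'| ≤ 40 * M := by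
  refine integral_strip_le hM hl (fun x hx => ?_) (fun x => ?_) (fun x hx => ?_)
  · rw [cutoff_eq_zero hx, mul_zero]
  · rw [abs_mul, abs_mul, abs_of_nonneg (cutoff_nonneg x)]
    exact mul_le_one₀ (mul_le_one₀ (hψ.abs_le_one _) (abs_nonneg _) (hψ.abs_le_one _))
      (cutoff_nonneg x) (cutoff_le_one x)
  · rw [hψ.eq_zero _ hx, zero_mul, zero_mul]

lemma integral_Icc_indicator_const {p q K : ℝ} (h : p ≤ q) :
    ∫ u : ℝ, (Set.Icc p q).indicator (fun _ => K) u = (q - p) * K := by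
  rw [integral_indicator measurableSet_Icc, setIntegral_const]
  simp [h]

lemma integrable_Icc_indicator_const (p q K : ℝ) :
    Integrable ((Set.Icc p q).indicator (fun _ => K)) := by
  rw [integrable_indicator_iff measurableSet_Icc]
  exact integrableOn_const (by simp)

lemma IsProfile.integrable {M : ℝ} {ψ : ℝ → ℝ} (hψ : IsProfile M ψ) : Integrable ψ :=
  (integrable_Icc_indicator_const (-M) M 1).mono' hψ.measurable.aestronglyMeasurable
    (Filter.Eventually.of_forall hψ.abs_le_indicator)

/-- A mean zero profile tested against a Lipschitz function. -/
lemma IsProfile.abs_integral_mul_le {M L c : ℝ} (hM : 0 ≤ M) {ψ : ℝ → ℝ}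
    (hψ : IsProfile M ψ) {f : ℝ → ℝ} (hfm : Measurable f) (hf1 : ∀ u, |f u| ≤ 1)
    (hf : ∀ u v, |f u - f v| ≤ L * |u - v|) :
    |∫ u, ψ (u - c) * f u| ≤ 2 * M ^ 2 * L := by
  have hi : Integrable fun u => ψ (u - c) := hψ.integrable.comp_sub_right c
  have h0 : ∫ u, ψ (u - c) * f c = 0 := by
    rw [integral_mul_const, integral_sub_right_eq_self ψ c, hψ.integral_eq_zero, zero_mul]
  have hi2 : Integrable fun u => ψ (u - c) * f u := by
    refine hi.mul_bdd (c := 1) hfm.aestronglyMeasurable (Filter.Eventually.of_forall fun u => ?_)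
    exact hf1 u
  have h1 : ∫ u, ψ (u - c) * f u = ∫ u, ψ (u - c) * (f u - f c) := by
    simp_rw [mul_sub]
    rw [integral_sub hi2 (hi.mul_const _), h0, sub_zero]
  have hL : 0 ≤ L := by
    have := hf 1 0
    have h' := abs_nonneg (f 1 - f 0)
    norm_num at this
    linarith
  rw [h1]
  have h2 : ∀ u, ‖ψ (u - c) * (f u - f c)‖ ≤
      (Set.Icc (c - M) (c + M)).indicator (fun _ => M * L) u := by
    intro u
    by_cases hu : u ∈ Set.Icc (c - M) (c + M)
    · rw [Set.indicator_of_mem hu, norm_mul, Real.norm_eq_abs, Real.norm_eq_abs]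
      have h3 : |u - c| ≤ M := by rw [abs_le]; constructor <;> linarith [hu.1, hu.2]
      calc |ψ (u - c)| * |f u - f c| ≤ 1 * (L * |u - c|) :=
            mul_le_mul (hψ.abs_le_one _) (hf u c) (abs_nonneg _) zero_le_one
        _ ≤ M * L := by nlinarith
    · rw [Set.indicator_of_notMem hu, hψ.eq_zero, zero_mul, norm_zero]
      by_contra h3
      rw [not_lt, abs_le] at h3
      exact hu ⟨by linarith, by linarith⟩
  refine (norm_integral_le_of_norm_le (integrable_Icc_indicator_const _ _ _)
    (Filter.Eventually.of_forall h2)).trans ?_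
  rw [integral_Icc_indicator_const (by linarith)]
  nlinarith

lemma abs_crossTerm_le_of_det {M : ℝ} (hM : 0 ≤ M) {ψ : ℝ → ℝ} (hψ : IsProfile M ψ)
    {l l' : ℝ × ℝ × ℝ} (hl' : l'.1 ^ 2 + l'.2.1 ^ 2 = 1)
    (hd : formDet l l' ≠ 0) : |crossTerm ψ l l'| ≤ 4 * M ^ 3 / formDet l l' ^ 2 := by
  set σ := formDet l l' with hσ
  let g : ℝ × ℝ → ℝ × ℝ := fun y =>
    (σ⁻¹ * (l'.2.1 * y.1 - l.2.1 * y.2), σ⁻¹ * (l.1 * y.2 - l'.1 * y.1))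
  have hgc : Continuous g := by fun_prop
  let Ψ : ℝ × ℝ → ℝ := fun y => ψ (y.1 - l.2.2) * ψ (y.2 - l'.2.2) * cutoff (g y)
  have hΨm : Measurable Ψ :=
    ((hψ.measurable.comp (by fun_prop)).mul (hψ.measurable.comp (by fun_prop))).mul
      (continuous_cutoff.comp hgc).measurable
  have hcomp : crossTerm ψ l l' = |σ|⁻¹ * ∫ y, Ψ y := by
    have h := integral_comp_two_forms (a := l.1) (b := l.2.1) (c := l'.1) (d := l'.2.1) hd hΨm
    rw [hσ, formDet, ← h, crossTerm]
    congr 1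
    funext x
    have hx : g (l.1 * x.1 + l.2.1 * x.2, l'.1 * x.1 + l'.2.1 * x.2) = x := by
      ext
      · simp only [g]
        rw [inv_mul_eq_iff_eq_mul₀ hd, hσ, formDet]; ring
      · simp only [g]
        rw [inv_mul_eq_iff_eq_mul₀ hd, hσ, formDet]; ring
    simp only [Ψ, hx, lineForm]
  have hΨi : Integrable Ψ := by
    refine integrable_of_bounded_box hΨm (A := Set.Icc (l.2.2 - M) (l.2.2 + M))
      (B := Set.Icc (l'.2.2 - M) (l'.2.2 + M)) (K := 1) measurableSet_Icc measurableSet_Icc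
      (by simp) (by simp) fun y => ?_
    by_cases hy : y ∈ Set.Icc (l.2.2 - M) (l.2.2 + M) ×ˢ Set.Icc (l'.2.2 - M) (l'.2.2 + M)
    · rw [Set.indicator_of_mem hy, abs_mul, abs_mul, abs_of_nonneg (cutoff_nonneg _)]
      exact mul_le_one₀ (mul_le_one₀ (hψ.abs_le_one _) (abs_nonneg _) (hψ.abs_le_one _))
        (cutoff_nonneg _) (cutoff_le_one _)
    · rw [Set.indicator_of_notMem hy]
      by_contra hne
      apply hy
      have h1 : ψ (y.1 - l.2.2) ≠ 0 := fun h => hne (by simp [Ψ, h])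
      have h2 : ψ (y.2 - l'.2.2) ≠ 0 := fun h => hne (by simp [Ψ, h])
      have h1' := abs_le.1 (not_lt.1 fun h => h1 (hψ.eq_zero _ h))
      have h2' := abs_le.1 (not_lt.1 fun h => h2 (hψ.eq_zero _ h))
      exact ⟨⟨by linarith, by linarith⟩, ⟨by linarith, by linarith⟩⟩
  have hinner : ∀ v : ℝ, |∫ u, Ψ (u, v)| ≤
      (Set.Icc (l'.2.2 - M) (l'.2.2 + M)).indicator (fun _ => 2 * M ^ 2 * |σ|⁻¹) v := by
    intro v
    have e : ∫ u, Ψ (u, v) = ψ (v - l'.2.2) * ∫ u, ψ (u - l.2.2) * cutoff (g (u, v)) := by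
      rw [← integral_const_mul]
      congr 1
      funext u
      simp only [Ψ]; ring
    rw [e, abs_mul]
    by_cases hv : v ∈ Set.Icc (l'.2.2 - M) (l'.2.2 + M)
    · rw [Set.indicator_of_mem hv]
      have hb := hψ.abs_integral_mul_le (c := l.2.2) (L := |σ|⁻¹) hM
        (f := fun u => cutoff (g (u, v)))
        (continuous_cutoff.comp (hgc.comp (by fun_prop))).measurable
        (fun u => by rw [abs_of_nonneg (cutoff_nonneg _)]; exact cutoff_le_one _)
        (fun u u' => by
          refine (abs_cutoff_sub_le _ _).trans ?_
          have e1 : g (u, v) - g (u', v) = (σ⁻¹ * (l'.2.1 * (u - u')), σ⁻¹ * (-l'.1 * (u - u'))) := by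
            ext <;> simp only [g, Prod.fst_sub, Prod.snd_sub] <;> ring
          have h1 : |l'.1| ≤ 1 := abs_le_one_iff_mul_self_le_one.2 (by nlinarith [sq_nonneg l'.2.1])
          have h2 : |l'.2.1| ≤ 1 := abs_le_one_iff_mul_self_le_one.2 (by nlinarith [sq_nonneg l'.1])
          have h3 := abs_nonneg (u - u')
          rw [e1, Prod.norm_def, max_le_iff]
          simp only [Real.norm_eq_abs, abs_mul, abs_inv, abs_neg]
          exact ⟨mul_le_mul_of_nonneg_left (by nlinarith) (by positivity),
            mul_le_mul_of_nonneg_left (by nlinarith) (by positivity)⟩)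
      exact (mul_le_mul (hψ.abs_le_one _) hb (abs_nonneg _) zero_le_one).trans (by rw [one_mul])
    · rw [Set.indicator_of_notMem hv, hψ.eq_zero, abs_zero, zero_mul]
      by_contra h3
      rw [not_lt, abs_le] at h3
      exact hv ⟨by linarith, by linarith⟩
  have hsw : ∫ y, Ψ y = ∫ v, ∫ u, Ψ (u, v) := by
    rw [Measure.volume_eq_prod] at hΨi ⊢
    exact integral_prod_symm Ψ hΨi
  have hΨ : |∫ y, Ψ y| ≤ 2 * M * (2 * M ^ 2 * |σ|⁻¹) := by
    rw [hsw]
    refine (norm_integral_le_of_norm_le (integrable_Icc_indicator_const _ _ _)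
      (Filter.Eventually.of_forall fun v => (Real.norm_eq_abs _).trans_le (hinner v))).trans ?_
    rw [integral_Icc_indicator_const (by linarith)]
    apply le_of_eq; ring
  rw [hcomp, abs_mul, abs_inv, abs_abs]
  calc |σ|⁻¹ * |∫ y, Ψ y| ≤ |σ|⁻¹ * (2 * M * (2 * M ^ 2 * |σ|⁻¹)) :=
        mul_le_mul_of_nonneg_left hΨ (by positivity)
    _ = 4 * M ^ 3 / σ ^ 2 := by
        rw [← sq_abs σ, div_eq_mul_inv, sq |σ|, mul_inv]; ring

/-- The difference of the indicators of an interval and of its normalised dilate. -/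
noncomputable def highProfile (S m u : ℝ) : ℝ :=
  (Set.Icc (-m) m).indicator (fun _ => (1 : ℝ)) u
    - S⁻¹ * (Set.Icc (-(S * m)) (S * m)).indicator (fun _ => (1 : ℝ)) u

lemma isProfile_highProfile {S m : ℝ} (hS : 1 ≤ S) (hm : 0 ≤ m) :
    IsProfile (S * m) (highProfile S m) where
  measurable := (measurable_const.indicator measurableSet_Icc).sub
    (measurable_const.mul (measurable_const.indicator measurableSet_Icc))
  abs_le_one u := by
    have h1 : S⁻¹ ≤ 1 := inv_le_one_of_one_le₀ hS
    have h2 : 0 ≤ S⁻¹ := by positivity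
    unfold highProfile Set.indicator
    rw [abs_le]
    split_ifs <;> constructor <;> linarith
  eq_zero u hu := by
    have h1 : u ∉ Set.Icc (-(S * m)) (S * m) := fun h => absurd (abs_le.2 h) (not_le.2 hu)
    have h2 : u ∉ Set.Icc (-m) m := fun h => absurd ((abs_le.2 h).trans (by nlinarith)) (not_le.2 hu)
    simp [highProfile, h1, h2]
  integral_eq_zero := by
    unfold highProfile
    have : 0 ≤ S * m := by positivity
    rw [integral_sub (integrable_Icc_indicator_const _ _ _)
      ((integrable_Icc_indicator_const _ _ _).const_mul _), integral_const_mul,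
      integral_Icc_indicator_const (by linarith), integral_Icc_indicator_const (by linarith)]
    field_simp
    ring

/-- Two lines that meet, up to an error `ρ`, in a bounded region and make an angle at most `ρ`. -/
def CloseLines (ρ : ℝ) (l l' : ℝ × ℝ × ℝ) : Prop :=
  ∃ x : ℝ × ℝ, ‖x‖ ≤ 5 ∧ |lineForm l x| ≤ ρ ∧ |lineForm l' x| ≤ ρ ∧ |formDet l l'| ≤ ρ

open Classical in
lemma sum_abs_crossTerm_le {ι : Type*} {T : Finset ι} {l : ι → ℝ × ℝ × ℝ}
    (hT : ∀ t ∈ T, (l t).1 ^ 2 + (l t).2.1 ^ 2 = 1) {M R B : ℝ} (hM : 0 < M) (hR : 1 ≤ R)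
    {ψ : ℝ → ℝ} (hψ : IsProfile M ψ) {J : ℕ} (hJ : 1 ≤ R ^ J * M) {t : ι} (ht : t ∈ T)
    (hcount : ∀ j : ℕ, ((T.filter fun s => CloseLines (R ^ j * M) (l t) (l s)).card : ℝ)
      ≤ B * R ^ (2 * j)) :
    ∑ s ∈ T, |crossTerm ψ (l t) (l s)| ≤ (J + 1) * (40 * R ^ 2 * M * B) := by
  have hR0 : 0 < R := by linarith
  have hs : ∀ s ∈ T, |crossTerm ψ (l t) (l s)| ≤ ∑ j ∈ Finset.range (J + 1),
      if CloseLines (R ^ j * M) (l t) (l s) then 40 * R ^ 2 * M / R ^ (2 * j) else 0 := by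
    intro s hs
    have hnn : ∀ j ∈ Finset.range (J + 1),
        0 ≤ if CloseLines (R ^ j * M) (l t) (l s) then 40 * R ^ 2 * M / R ^ (2 * j) else 0 := by
      intro j _
      split_ifs <;> positivity
    by_cases hmeet : ∃ x : ℝ × ℝ, ‖x‖ ≤ 5 ∧ |lineForm (l t) x| ≤ M ∧ |lineForm (l s) x| ≤ M
    · obtain ⟨x, hx, hxt, hxs⟩ := hmeet
      have hdet1 : |formDet (l t) (l s)| ≤ 1 := by
        rw [abs_le_one_iff_mul_self_le_one]
        have h1 := hT t ht
        have h2 := hT s hs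
        unfold formDet
        nlinarith [sq_nonneg ((l t).1 * (l s).1 + (l t).2.1 * (l s).2.1)]
      have hex : ∃ j, |formDet (l t) (l s)| ≤ R ^ j * M := ⟨J, hdet1.trans hJ⟩
      have hjJ : Nat.find hex ≤ J := Nat.find_min' hex (hdet1.trans hJ)
      have hjs := Nat.find_spec hex
      have hM' : M ≤ R ^ (Nat.find hex) * M :=
        le_mul_of_one_le_left hM.le (one_le_pow₀ hR)
      have hclose : CloseLines (R ^ (Nat.find hex) * M) (l t) (l s) :=
        ⟨x, hx, hxt.trans hM', hxs.trans hM', hjs⟩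
      refine le_trans ?_ (Finset.single_le_sum hnn (Finset.mem_range.2 (Nat.lt_succ_of_le hjJ)))
      rw [if_pos hclose]
      rcases hj : Nat.find hex with _ | i
      · refine (abs_crossTerm_le hM.le hψ (hT t ht)).trans ?_
        have : 1 ≤ R ^ 2 := one_le_pow₀ hR
        simp only [mul_zero, pow_zero, div_one]
        nlinarith
      · have hi : R ^ i * M < |formDet (l t) (l s)| :=
          not_le.1 (Nat.find_min hex (m := i) (by omega))
        have hpos : 0 < R ^ i * M := by positivity
        have hd : formDet (l t) (l s) ≠ 0 := abs_pos.1 (hpos.trans hi)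
        refine (abs_crossTerm_le_of_det hM.le hψ (hT s hs) hd).trans ?_
        have hsq : (R ^ i * M) ^ 2 ≤ formDet (l t) (l s) ^ 2 := by
          rw [← sq_abs (formDet _ _)]
          exact pow_le_pow_left₀ hpos.le hi.le 2
        calc 4 * M ^ 3 / formDet (l t) (l s) ^ 2 ≤ 4 * M ^ 3 / (R ^ i * M) ^ 2 :=
              div_le_div_of_nonneg_left (by positivity) (by positivity) hsq
          _ = 4 * R ^ 2 * M / R ^ (2 * (i + 1)) := by
              field_simp
              ring
          _ ≤ _ := by gcongr; norm_num
    · rw [cross_eq_zero hψ hmeet, abs_zero]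
      exact Finset.sum_nonneg hnn
  calc ∑ s ∈ T, |crossTerm ψ (l t) (l s)| ≤ ∑ s ∈ T, ∑ j ∈ Finset.range (J + 1),
      (if CloseLines (R ^ j * M) (l t) (l s) then 40 * R ^ 2 * M / R ^ (2 * j) else 0) :=
        Finset.sum_le_sum hs
    _ = ∑ j ∈ Finset.range (J + 1), ((T.filter fun s => CloseLines (R ^ j * M) (l t) (l s)).card : ℝ)
          * (40 * R ^ 2 * M / R ^ (2 * j)) := by
        rw [Finset.sum_comm]
        refine Finset.sum_congr rfl fun j _ => ?_
        rw [← Finset.sum_filter, Finset.sum_const, nsmul_eq_mul]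
    _ ≤ ∑ j ∈ Finset.range (J + 1), 40 * R ^ 2 * M * B := by
        refine Finset.sum_le_sum fun j _ => ?_
        calc _ ≤ B * R ^ (2 * j) * (40 * R ^ 2 * M / R ^ (2 * j)) :=
              mul_le_mul_of_nonneg_right (hcount j) (by positivity)
          _ = 40 * R ^ 2 * M * B := by field_simp
    _ = _ := by simp

lemma integrable_sum_profile_sq {ι : Type*} (T : Finset ι) (l : ι → ℝ × ℝ × ℝ) {M : ℝ}
    {ψ : ℝ → ℝ} (hψ : IsProfile M ψ) :
    Integrable fun x => (∑ t ∈ T, ψ (lineForm (l t) x)) ^ 2 * cutoff x := by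
  have e : (fun x => (∑ t ∈ T, ψ (lineForm (l t) x)) ^ 2 * cutoff x) = fun x =>
      ∑ t ∈ T, ∑ s ∈ T, ψ (lineForm (l t) x) * ψ (lineForm (l s) x) * cutoff x := by
    funext x
    rw [sq, Finset.sum_mul_sum, Finset.sum_mul]
    simp_rw [Finset.sum_mul]
  rw [e]
  exact integrable_finsetSum _ fun t _ => integrable_finsetSum _ fun s _ =>
    hψ.integrable_cross _ _

lemma integral_sum_profile_sq_le {ι : Type*} (T : Finset ι) (l : ι → ℝ × ℝ × ℝ) {M : ℝ}
    {ψ : ℝ → ℝ} (hψ : IsProfile M ψ) :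
    ∫ x, (∑ t ∈ T, ψ (lineForm (l t) x)) ^ 2 * cutoff x
      ≤ ∑ t ∈ T, ∑ s ∈ T, |crossTerm ψ (l t) (l s)| := by
  have e : (fun x => (∑ t ∈ T, ψ (lineForm (l t) x)) ^ 2 * cutoff x) = fun x =>
      ∑ t ∈ T, ∑ s ∈ T, ψ (lineForm (l t) x) * ψ (lineForm (l s) x) * cutoff x := by
    funext x
    rw [sq, Finset.sum_mul_sum, Finset.sum_mul]
    simp_rw [Finset.sum_mul]
  rw [e, integral_finsetSum _ fun t _ => integrable_finsetSum _ fun s _ =>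
    hψ.integrable_cross _ _]
  refine Finset.sum_le_sum fun t _ => ?_
  rw [integral_finsetSum _ fun s _ => hψ.integrable_cross _ _]
  exact Finset.sum_le_sum fun s _ => le_abs_self _

/-- Comparison of a sum over separated points with an integral. -/
lemma sum_le_integral_of_separated {κ : Type*} {Q : Finset κ} {z : κ → ℝ × ℝ} {w : ℝ}
    (hw : 0 < w) (hQ : ∀ p ∈ Q, ∀ q ∈ Q, p ≠ q → w < ‖z p - z q‖) {F : ℝ × ℝ → ℝ}
    (hF : Integrable F) (hF0 : ∀ x, 0 ≤ F x) {v : κ → ℝ}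
    (hv : ∀ q ∈ Q, ∀ x, ‖x - z q‖ ≤ w / 2 → v q ≤ F x) :
    w ^ 2 * ∑ q ∈ Q, v q ≤ ∫ x, F x := by
  have hvol : ∀ q, volume.real (Metric.closedBall (z q) (w / 2)) = w ^ 2 := by
    intro q
    rw [← closedBall_prod_same, Measure.volume_eq_prod, measureReal_prod_prod]
    simp [Real.volume_real_closedBall (by positivity : 0 ≤ w / 2)]
    ring
  calc w ^ 2 * ∑ q ∈ Q, v q = ∑ q ∈ Q, v q * volume.real (Metric.closedBall (z q) (w / 2)) := by
        simp_rw [hvol]; rw [Finset.mul_sum]; simp_rw [mul_comm]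
    _ ≤ ∑ q ∈ Q, ∫ x in Metric.closedBall (z q) (w / 2), F x := by
        refine Finset.sum_le_sum fun q hq => ?_
        refine setIntegral_ge_of_const_le_real measurableSet_closedBall
          (measure_closedBall_lt_top).ne (fun x hx => hv q hq x ?_) hF.integrableOn
        rwa [mem_closedBall_iff_norm] at hx
    _ = ∫ x in ⋃ q ∈ Q, Metric.closedBall (z q) (w / 2), F x := by
        rw [integral_biUnion_finset _ (fun q _ => measurableSet_closedBall) ?_
          (fun q _ => hF.integrableOn)]
        intro p hp q hq hpq
        apply Metric.closedBall_disjoint_closedBall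
        rw [dist_eq_norm]
        linarith [hQ p hp q hq hpq]
    _ ≤ ∫ x, F x := setIntegral_le_integral hF (Filter.Eventually.of_forall hF0)

open Classical in
/-- The number of lines passing within `ρ` of `x`. -/
noncomputable def lineCount {ι : Type*} (T : Finset ι) (l : ι → ℝ × ℝ × ℝ) (ρ : ℝ) (x : ℝ × ℝ) : ℝ :=
  (T.filter fun t => |lineForm (l t) x| ≤ ρ).card

section lineCount
variable {ι : Type*} {T : Finset ι} {l : ι → ℝ × ℝ × ℝ}

lemma lineCount_nonneg (ρ : ℝ) (x : ℝ × ℝ) : 0 ≤ lineCount T l ρ x := Nat.cast_nonneg _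

lemma lineCount_le_card (ρ : ℝ) (x : ℝ × ℝ) : lineCount T l ρ x ≤ T.card := by
  unfold lineCount
  exact_mod_cast Finset.card_filter_le _ _

lemma abs_lineForm_sub_le {a : ℝ × ℝ × ℝ} (ha : a.1 ^ 2 + a.2.1 ^ 2 = 1) (x y : ℝ × ℝ) :
    |lineForm a x - lineForm a y| ≤ 2 * ‖x - y‖ := by
  have h1 : |a.1| ≤ 1 := abs_le_one_iff_mul_self_le_one.2 (by nlinarith [sq_nonneg a.2.1])
  have h2 : |a.2.1| ≤ 1 := abs_le_one_iff_mul_self_le_one.2 (by nlinarith [sq_nonneg a.1])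
  have e : lineForm a x - lineForm a y = a.1 * (x - y).1 + a.2.1 * (x - y).2 := by
    simp [lineForm]; ring
  have h3 : |(x - y).1| ≤ ‖x - y‖ := norm_fst_le (x - y)
  have h4 : |(x - y).2| ≤ ‖x - y‖ := norm_snd_le (x - y)
  rw [e]
  refine (abs_add_le _ _).trans ?_
  rw [abs_mul, abs_mul]
  nlinarith [abs_nonneg (x - y).1, abs_nonneg (x - y).2]

lemma lineCount_le_lineCount (hT : ∀ t ∈ T, (l t).1 ^ 2 + (l t).2.1 ^ 2 = 1) {ρ ρ' : ℝ}
    {x y : ℝ × ℝ} (h : ρ + 2 * ‖x - y‖ ≤ ρ') : lineCount T l ρ x ≤ lineCount T l ρ' y := by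
  classical
  unfold lineCount
  norm_cast
  refine Finset.card_le_card fun t ht => ?_
  rw [Finset.mem_filter] at ht ⊢
  refine ⟨ht.1, ?_⟩
  have h1 := abs_lineForm_sub_le (hT t ht.1) x y
  have h2 := abs_sub_abs_le_abs_sub (lineForm (l t) y) (lineForm (l t) x)
  rw [abs_sub_comm] at h2
  linarith [ht.2]

lemma sum_highProfile (S m : ℝ) (x : ℝ × ℝ) : ∑ t ∈ T, highProfile S m (lineForm (l t) x)
    = lineCount T l m x - S⁻¹ * lineCount T l (S * m) x := by
  classical
  have key : ∀ ρ : ℝ, lineCount T l ρ x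
      = ∑ t ∈ T, (Set.Icc (-ρ) ρ).indicator (fun _ => (1 : ℝ)) (lineForm (l t) x) := by
    intro ρ
    simp only [lineCount, Finset.card_filter, Nat.cast_sum, Set.indicator, Set.mem_Icc, abs_le]
    exact Finset.sum_congr rfl fun t _ => by split_ifs <;> simp
  simp only [highProfile, key, Finset.sum_sub_distrib, Finset.mul_sum]

/-- At scale `w` the counting function near `x` is dominated by its high frequency part. -/
def IsHighAt (T : Finset ι) (l : ι → ℝ × ℝ × ℝ) (S w : ℝ) (y : ℝ × ℝ) : Prop :=
  ∀ x, ‖x - y‖ ≤ w / 2 →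
    lineCount T l (5 * w) x ≤ 2 * |∑ t ∈ T, highProfile S (5 * w) (lineForm (l t) x)|

lemma lineCount_le_of_not_isHighAt (hT : ∀ t ∈ T, (l t).1 ^ 2 + (l t).2.1 ^ 2 = 1) {S w : ℝ}
    (hS : 1 ≤ S) (hw : 0 < w) {y : ℝ × ℝ} (h : ¬ IsHighAt T l S w y) :
    lineCount T l (4 * w) y ≤ 2 * S⁻¹ * lineCount T l (4 * (2 * S * w)) y := by
  unfold IsHighAt at h
  push Not at h
  obtain ⟨x, hx, hlt⟩ := h
  rw [sum_highProfile] at hlt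
  have h1 : lineCount T l (4 * w) y ≤ lineCount T l (5 * w) x :=
    lineCount_le_lineCount hT (by rw [norm_sub_rev]; linarith)
  have h2 : lineCount T l (S * (5 * w)) x ≤ lineCount T l (4 * (2 * S * w)) y :=
    lineCount_le_lineCount hT (by nlinarith)
  have h3 := mul_le_mul_of_nonneg_left h2 (by positivity : 0 ≤ S⁻¹)
  have h4 := le_abs_self (lineCount T l (5 * w) x - S⁻¹ * lineCount T l (S * (5 * w)) x)
  linarith

lemma exists_stopping_scale (hT : ∀ t ∈ T, (l t).1 ^ 2 + (l t).2.1 ^ 2 = 1) {S δ : ℝ}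
    (hS : 1 ≤ S) (hδ : 0 < δ) (y : ℝ × ℝ) (n : ℕ) :
    ∃ k ≤ n, (2 * S) ^ k * lineCount T l (4 * δ) y
        ≤ 4 ^ k * lineCount T l (4 * ((2 * S) ^ k * δ)) y ∧
      (k = n ∨ IsHighAt T l S ((2 * S) ^ k * δ) y) := by
  induction n with
  | zero => exact ⟨0, le_rfl, by simp, Or.inl rfl⟩
  | succ n ih =>
    obtain ⟨k, hk, h1, h2⟩ := ih
    by_cases hh : IsHighAt T l S ((2 * S) ^ k * δ) y
    · exact ⟨k, hk.trans n.le_succ, h1, Or.inr hh⟩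
    · have hkn : k = n := h2.resolve_right hh
      subst hkn
      refine ⟨k + 1, le_rfl, ?_, Or.inl rfl⟩
      have h3 := lineCount_le_of_not_isHighAt hT hS (by positivity) hh
      have e : 4 * (2 * S * ((2 * S) ^ k * δ)) = 4 * ((2 * S) ^ (k + 1) * δ) := by ring
      rw [e] at h3
      set N := lineCount T l (4 * ((2 * S) ^ (k + 1) * δ)) y
      calc (2 * S) ^ (k + 1) * lineCount T l (4 * δ) y
          = 2 * S * ((2 * S) ^ k * lineCount T l (4 * δ) y) := by ring
        _ ≤ 2 * S * (4 ^ k * (2 * S⁻¹ * N)) := by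
            refine mul_le_mul_of_nonneg_left (h1.trans ?_) (by positivity)
            exact mul_le_mul_of_nonneg_left h3 (by positivity)
        _ = 4 ^ (k + 1) * N := by field_simp; ring

open Classical in
/-- The `L²` estimate at the stopping scale. -/
lemma sum_lineCount_sq_le (hT : ∀ t ∈ T, (l t).1 ^ 2 + (l t).2.1 ^ 2 = 1)
    {α K δ S : ℝ} (hα0 : 0 ≤ α) (hα2 : α ≤ 2) (hK : 1 ≤ K) (hδ : 0 < δ) (hS : 1 ≤ S)
    (hclose : ∀ t ∈ T, ∀ ρ, δ ≤ ρ →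
      ((T.filter fun s => CloseLines ρ (l t) (l s)).card : ℝ) ≤ 576 * K * (ρ / δ) ^ α)
    (hcard : (T.card : ℝ) ≤ K * (1 / δ) ^ α) {n k : ℕ} (hk : k ≤ n)
    (hn : (2 * S) ^ n * δ ≤ 1) (hn' : 1 ≤ (2 * S) ^ (n + 1) * δ)
    {κ : Type*} {Q : Finset κ} {z : κ → ℝ × ℝ} (hz : ∀ q ∈ Q, ‖z q‖ ≤ 1)
    (hQ : ∀ p ∈ Q, ∀ q ∈ Q, p ≠ q → (2 * S) ^ k * δ < ‖z p - z q‖)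
    (hhigh : ∀ q ∈ Q, k = n ∨ IsHighAt T l S ((2 * S) ^ k * δ) (z q)) :
    ((2 * S) ^ k * δ) * ∑ q ∈ Q, lineCount T l (4 * ((2 * S) ^ k * δ)) (z q) ^ 2
      ≤ 11520000 * (2 * S) ^ 5 * (n + 2) * T.card * (K * ((2 * S) ^ k) ^ α) := by
  set R := 2 * S with hR
  set W := R ^ k with hW
  set w := W * δ with hw
  have hR2 : 2 ≤ R := by linarith
  have hR1 : 1 ≤ R := by linarith
  have hR0 : 0 < R := by linarith
  have hW1 : 1 ≤ W := one_le_pow₀ hR1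
  have hw0 : 0 < w := by positivity
  have hw1 : w ≤ 1 := (mul_le_mul_of_nonneg_right (pow_le_pow_right₀ hR1 hk) hδ.le).trans hn
  have hpowle : ∀ c : ℝ, 1 ≤ c → (c * W) ^ α ≤ c ^ 2 * W ^ α := by
    intro c hc
    rw [Real.mul_rpow (by linarith) (by linarith)]
    refine mul_le_mul_of_nonneg_right ?_ (by positivity)
    rw [← Real.rpow_natCast]
    exact Real.rpow_le_rpow_of_exponent_le hc (by exact_mod_cast hα2)
  have hx4 : ∀ q ∈ Q, ∀ x, ‖x - z q‖ ≤ w / 2 → ‖x‖ ≤ 4 := by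
    intro q hq x hx
    have := norm_le_norm_add_norm_sub' x (z q)
    linarith [hz q hq]
  suffices h : w ^ 2 * ∑ q ∈ Q, lineCount T l (4 * w) (z q) ^ 2
      ≤ w * (11520000 * R ^ 5 * (n + 2) * T.card * (K * W ^ α)) by
    rw [sq w, mul_assoc] at h
    exact le_of_mul_le_mul_left h hw0
  by_cases hkn : k = n
  · have hsep := sum_le_integral_of_separated hw0 hQ
      (integrable_cutoff.const_mul ((T.card : ℝ) ^ 2))
      (fun x => mul_nonneg (sq_nonneg _) (cutoff_nonneg x))
      (v := fun q => lineCount T l (4 * w) (z q) ^ 2) (fun q hq x hx => by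
        rw [cutoff_eq_one (hx4 q hq x hx), mul_one]
        exact pow_le_pow_left₀ (lineCount_nonneg _ _) (lineCount_le_card _ _) 2)
    rw [integral_const_mul] at hsep
    have hRw : 1 ≤ R * w := by
      rw [hw, hW, hkn, ← mul_assoc, ← pow_succ']; exact hn'
    have hD : (1 / δ) ^ α ≤ R ^ 2 * W ^ α := by
      refine le_trans (Real.rpow_le_rpow (by positivity) ?_ hα0) (hpowle R hR1)
      rw [div_le_iff₀ hδ, mul_assoc]
      exact hRw
    have hT2 : (T.card : ℝ) ≤ K * (R ^ 2 * W ^ α) :=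
      hcard.trans (mul_le_mul_of_nonneg_left hD (by linarith))
    calc w ^ 2 * ∑ q ∈ Q, lineCount T l (4 * w) (z q) ^ 2 ≤ (T.card : ℝ) ^ 2 * 100 :=
          hsep.trans (mul_le_mul_of_nonneg_left integral_cutoff_le (sq_nonneg _))
      _ = 1 * (100 * T.card * T.card) := by ring
      _ ≤ (R * w) * (100 * T.card * (K * (R ^ 2 * W ^ α))) := by gcongr
      _ = w * (100 * R ^ 3 * 1 * T.card * (K * W ^ α)) := by ring
      _ ≤ w * (11520000 * R ^ 5 * (n + 2) * T.card * (K * W ^ α)) := by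
          have hn1 : (1 : ℝ) ≤ n + 2 := by
            have : (0 : ℝ) ≤ n := Nat.cast_nonneg n
            linarith
          have h35 : R ^ 3 ≤ R ^ 5 := pow_le_pow_right₀ hR1 (by norm_num)
          gcongr
          norm_num
  · have hprof := isProfile_highProfile (S := S) (m := 5 * w) hS (by positivity)
    set M := S * (5 * w) with hM
    have hM0 : 0 < M := by positivity
    have hδM : δ ≤ M := by
      have : δ ≤ w := le_mul_of_one_le_left hδ.le hW1
      nlinarith
    have hJ : 1 ≤ R ^ (n + 1) * M :=
      hn'.trans (mul_le_mul_of_nonneg_left hδM (by positivity))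
    set B := 14400 * R ^ 2 * (K * W ^ α) with hB
    have hB0 : 0 ≤ B := by positivity
    have hcross : ∀ t ∈ T, ∑ s ∈ T, |crossTerm (highProfile S (5 * w)) (l t) (l s)|
        ≤ ((n + 1 : ℕ) + 1) * (40 * R ^ 2 * M * B) := by
      intro t ht
      refine sum_abs_crossTerm_le hT hM0 hR1 hprof hJ ht fun j => ?_
      have hj1 : 1 ≤ R ^ j := one_le_pow₀ hR1
      refine (hclose t ht _ (hδM.trans (le_mul_of_one_le_left hM0.le hj1))).trans ?_
      have e : R ^ j * M / δ = (R ^ j * (5 * S)) * W := by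
        rw [hM, hw]; field_simp
      rw [e]
      have := hpowle (R ^ j * (5 * S)) (by nlinarith)
      calc 576 * K * (R ^ j * (5 * S) * W) ^ α
          ≤ 576 * K * ((R ^ j * (5 * S)) ^ 2 * W ^ α) :=
            mul_le_mul_of_nonneg_left this (by positivity)
        _ = 14400 * S ^ 2 * (K * W ^ α) * R ^ (2 * j) := by ring
        _ ≤ B * R ^ (2 * j) := by
            rw [hB]
            gcongr
            linarith
    have hI := (integral_sum_profile_sq_le T l hprof).trans (Finset.sum_le_sum hcross)
    rw [Finset.sum_const, nsmul_eq_mul] at hI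
    have hsep := sum_le_integral_of_separated hw0 hQ
      ((integrable_sum_profile_sq T l hprof).const_mul 4)
      (fun x => mul_nonneg (by norm_num) (mul_nonneg (sq_nonneg _) (cutoff_nonneg x)))
      (v := fun q => lineCount T l (4 * w) (z q) ^ 2) (fun q hq x hx => by
        have h1 : lineCount T l (4 * w) (z q) ≤ lineCount T l (5 * w) x :=
          lineCount_le_lineCount hT (by rw [norm_sub_rev]; linarith)
        have h2 := (hhigh q hq).resolve_left hkn x hx
        rw [cutoff_eq_one (hx4 q hq x hx), mul_one]
        have h3 := pow_le_pow_left₀ (lineCount_nonneg _ _) (h1.trans h2) 2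
        rw [mul_pow, sq_abs] at h3
        norm_num at h3
        exact h3)
    rw [integral_const_mul] at hsep
    refine hsep.trans ((mul_le_mul_of_nonneg_left hI (by norm_num)).trans ?_)
    have hSR : S ≤ R := by linarith
    calc 4 * (T.card * (((n + 1 : ℕ) + 1) * (40 * R ^ 2 * M * B)))
        = w * (800 * 14400 * (R ^ 4 * S) * (n + 2) * T.card * (K * W ^ α)) := by
          rw [hM, hB]; push_cast; ring
      _ ≤ w * (11520000 * (R ^ 4 * R) * (n + 2) * T.card * (K * W ^ α)) := by
          norm_num
          gcongr
      _ = _ := by ring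

end lineCount

lemma exists_maximal_separated {κ : Type*} (A : Finset κ) (z : κ → ℝ × ℝ) {w : ℝ} (hw : 0 ≤ w) :
    ∃ Q ⊆ A, (∀ p ∈ Q, ∀ q ∈ Q, p ≠ q → w < ‖z p - z q‖) ∧
      ∀ p ∈ A, ∃ q ∈ Q, ‖z p - z q‖ ≤ w := by
  classical
  induction A using Finset.induction_on with
  | empty => exact ⟨∅, subset_rfl, by simp, by simp⟩
  | insert a A ha ih =>
    obtain ⟨Q, hQA, hsep, hmax⟩ := ih
    by_cases h : ∃ q ∈ Q, ‖z a - z q‖ ≤ w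
    · refine ⟨Q, hQA.trans (Finset.subset_insert _ _), hsep, fun p hp => ?_⟩
      rcases Finset.mem_insert.1 hp with rfl | hp
      · exact h
      · exact hmax p hp
    · push Not at h
      refine ⟨insert a Q, Finset.insert_subset_insert _ hQA, fun p hp q hq hpq => ?_,
        fun p hp => ?_⟩
      · rcases Finset.mem_insert.1 hp with hpa | hpQ <;>
          rcases Finset.mem_insert.1 hq with hqa | hqQ
        · exact absurd (hpa.trans hqa.symm) hpq
        · rw [hpa]; exact h q hqQ
        · rw [norm_sub_rev, hqa]; exact h p hpQ
        · exact hsep p hpQ q hqQ hpq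
      · rcases Finset.mem_insert.1 hp with rfl | hp
        · exact ⟨p, Finset.mem_insert_self _ _, by simpa using hw⟩
        · obtain ⟨q, hq, hpq⟩ := hmax p hp
          exact ⟨q, Finset.mem_insert_of_mem hq, hpq⟩

open Classical in
/-- The number of sets `P t`, `t ∈ T`, containing `p`. -/
noncomputable def pointMult {ι κ : Type*} (T : Finset ι) (P : ι → Finset κ) (p : κ) : ℝ :=
  (T.filter fun t => p ∈ P t).card

open Classical in
lemma sum_pointMult {ι κ : Type*} (T : Finset ι) (P : ι → Finset κ) (A : Finset κ) :
    ∑ p ∈ A, pointMult T P p = ∑ t ∈ T, ((A.filter fun p => p ∈ P t).card : ℝ) := by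
  simp only [pointMult, Finset.card_filter, Nat.cast_sum]
  exact Finset.sum_comm

open Classical in
lemma pointMult_le_lineCount {ι κ : Type*} {T : Finset ι} {P : ι → Finset κ} {p : κ}
    {l : ι → ℝ × ℝ × ℝ} {ρ : ℝ} {x : ℝ × ℝ} (h : ∀ t ∈ T, p ∈ P t → |lineForm (l t) x| ≤ ρ) :
    pointMult T P p ≤ lineCount T l ρ x := by
  unfold pointMult lineCount
  norm_cast
  refine Finset.card_le_card fun t ht => ?_
  rw [Finset.mem_filter] at ht ⊢
  exact ⟨ht.1, h t ht.1 ht.2⟩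

open Classical in
/-- The incidences over a family of points are controlled by the line counts at a net. -/
lemma sum_pointMult_le {ι κ : Type*} {T : Finset ι} {l : ι → ℝ × ℝ × ℝ} {P : ι → Finset κ}
    {z : κ → ℝ × ℝ} (hT : ∀ t ∈ T, (l t).1 ^ 2 + (l t).2.1 ^ 2 = 1) {δ w B : ℝ} (hδw : δ ≤ w)
    (hP : ∀ t ∈ T, ∀ p ∈ P t, |lineForm (l t) (z p)| ≤ 2 * δ)
    (hB : ∀ t ∈ T, ∀ q, (((P t).filter fun p => ‖z p - q‖ ≤ w).card : ℝ) ≤ B)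
    {A Q : Finset κ} (hQ : ∀ p ∈ A, ∃ q ∈ Q, ‖z p - z q‖ ≤ w) :
    ∑ p ∈ A, pointMult T P p ≤ B * ∑ q ∈ Q, lineCount T l (4 * w) (z q) := by
  have hnn : ∀ p, 0 ≤ pointMult T P p := fun p => Nat.cast_nonneg _
  choose! c hcQ hc using hQ
  calc ∑ p ∈ A, pointMult T P p = ∑ q ∈ Q, ∑ p ∈ A.filter fun p => c p = q, pointMult T P p :=
        (Finset.sum_fiberwise_of_maps_to hcQ _).symm
    _ ≤ ∑ q ∈ Q, ∑ p ∈ A.filter fun p => ‖z p - z q‖ ≤ w, pointMult T P p := by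
        refine Finset.sum_le_sum fun q _ =>
          Finset.sum_le_sum_of_subset_of_nonneg (fun p hp => ?_) fun p _ _ => hnn p
        rw [Finset.mem_filter] at hp ⊢
        exact ⟨hp.1, hp.2 ▸ hc p hp.1⟩
    _ ≤ ∑ q ∈ Q, B * lineCount T l (4 * w) (z q) := by
        refine Finset.sum_le_sum fun q _ => ?_
        rw [sum_pointMult]
        calc ∑ t ∈ T, (((A.filter fun p => ‖z p - z q‖ ≤ w).filter fun p => p ∈ P t).card : ℝ)
            ≤ ∑ t ∈ T, if |lineForm (l t) (z q)| ≤ 4 * w then B else 0 := by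
              refine Finset.sum_le_sum fun t ht => ?_
              split_ifs with h
              · refine le_trans ?_ (hB t ht (z q))
                norm_cast
                refine Finset.card_le_card fun p hp => ?_
                simp only [Finset.mem_filter] at hp ⊢
                exact ⟨hp.2, hp.1.2⟩
              · rw [Finset.card_eq_zero.2, Nat.cast_zero]
                refine Finset.filter_eq_empty_iff.2 fun p hp hpt => h ?_
                have h1 := hP t ht p hpt
                have h2 := abs_lineForm_sub_le (hT t ht) (z p) (z q)
                have h3 := (Finset.mem_filter.1 hp).2
                have h4 := abs_sub_abs_le_abs_sub (lineForm (l t) (z q)) (lineForm (l t) (z p))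
                rw [abs_sub_comm] at h4
                linarith
          _ = B * lineCount T l (4 * w) (z q) := by
              rw [← Finset.sum_filter, Finset.sum_const, nsmul_eq_mul, mul_comm, lineCount]
    _ = _ := by rw [Finset.mul_sum]

lemma exists_scale_count {R δ : ℝ} (hR : 1 < R) (hδ : 0 < δ) (hδ1 : δ ≤ 1) :
    ∃ n : ℕ, R ^ n * δ ≤ 1 ∧ 1 ≤ R ^ (n + 1) * δ := by
  obtain ⟨n, h1, h2⟩ := exists_nat_pow_near (one_le_inv_iff₀.2 ⟨hδ, hδ1⟩) hR
  refine ⟨n, ?_, ?_⟩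
  · rwa [← le_div_iff₀ hδ, one_div]
  · rw [← div_le_iff₀ hδ, one_div]; exact h2.le

/-- The chain of inequalities behind the first bound at the stopping scale. -/
lemma sq_mul_sq_le_of_chain {I r W D w E x τ n a b c B N₁ N₂ : ℝ} (hI : I = 2 * x * r)
    (hW : W = D * w) (hr : 0 ≤ r) (hD : 0 ≤ D) (hw : 0 ≤ w) (hE : 1 ≤ E) (hx : 0 ≤ x)
    (hτ : 0 ≤ τ) (hn : 0 ≤ n) (ha : 0 ≤ a) (hb : 0 ≤ b) (hc : 0 ≤ c) (hB : 0 ≤ B)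
    (hnE : n + 1 ≤ E) (h₁ : I ≤ 2 * (n + 1) * (9 * b * c * N₁)) (h₂ : r * W * N₁ ≤ E * N₂)
    (h₃ : w * N₂ ≤ B * (n + 2) * τ * a) :
    I ^ 2 * W ^ 2 ≤ 72 * B * (E * E * E) * (a * b * c) * D * x * τ := by
  have hW0 : 0 ≤ W := hW ▸ mul_nonneg hD hw
  calc I ^ 2 * W ^ 2 = I * (2 * x * r) * (W * (D * w)) := by rw [← hW, ← hI]; ring
    _ ≤ (2 * (n + 1) * (9 * b * c * N₁)) * (2 * x * r) * (W * (D * w)) := by gcongr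
    _ = 36 * (n + 1) * b * c * x * D * w * (r * W * N₁) := by ring
    _ ≤ 36 * (n + 1) * b * c * x * D * w * (E * N₂) := by gcongr
    _ = 36 * (n + 1) * b * c * x * D * E * (w * N₂) := by ring
    _ ≤ 36 * (n + 1) * b * c * x * D * E * (B * (n + 2) * τ * a) := by gcongr
    _ ≤ 36 * E * b * c * x * D * E * (B * (2 * E) * τ * a) := by
        gcongr
        linarith
    _ = _ := by ring

open Classical in
/-- The two inequalities relating the number of incidences to the stopping scale `W`. -/
theorem exists_scale_incidence_bounds {e : ℝ} (he : 0 < e) (he1 : e ≤ 1) :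
    ∃ C : ℝ, 1 ≤ C ∧ ∀ {ι κ : Type} [DecidableEq κ] {T : Finset ι} {P : ι → Finset κ} {l : ι → ℝ × ℝ × ℝ}
      {z : κ → ℝ × ℝ} {α β Kα Kβ δ : ℝ}, 0 ≤ α → α ≤ 2 → 1 ≤ Kα → 1 ≤ Kβ → 0 < δ → δ ≤ 1 →
      (∀ t ∈ T, (l t).1 ^ 2 + (l t).2.1 ^ 2 = 1) →
      (∀ t ∈ T, ∀ p ∈ P t, |lineForm (l t) (z p)| ≤ 2 * δ) →
      (∀ t ∈ T, ∀ p ∈ P t, ‖z p‖ ≤ 1) →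
      (∀ t ∈ T, ∀ ρ, δ ≤ ρ →
        ((T.filter fun s => CloseLines ρ (l t) (l s)).card : ℝ) ≤ 576 * Kα * (ρ / δ) ^ α) →
      (T.card : ℝ) ≤ Kα * (1 / δ) ^ α →
      (∀ t ∈ T, ∀ q, ∀ w, δ ≤ w →
        (((P t).filter fun p => ‖z p - q‖ ≤ w).card : ℝ) ≤ 9 * Kβ * (w / δ) ^ β) →
      0 < ∑ t ∈ T, ((P t).card : ℝ) →
      ∃ W : ℝ, 1 ≤ W ∧
        (∑ t ∈ T, ((P t).card : ℝ)) ^ 2 * W ^ 2 ≤ C * (δ⁻¹) ^ (3 * e) * (Kα * Kβ) * δ⁻¹ *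
          (T.biUnion P).card * T.card * W ^ (α + β) ∧
        (∑ t ∈ T, ((P t).card : ℝ)) * W ≤ C * (δ⁻¹) ^ e * (T.biUnion P).card * T.card := by
  obtain ⟨R, hR4, hRe⟩ : ∃ R : ℝ, 4 ≤ R ∧ R ^ e = 4 := by
    refine ⟨(4 : ℝ) ^ e⁻¹, ?_, ?_⟩
    · calc (4 : ℝ) = 4 ^ (1 : ℝ) := (Real.rpow_one 4).symm
        _ ≤ (4 : ℝ) ^ e⁻¹ :=
          Real.rpow_le_rpow_of_exponent_le (by norm_num) (one_le_inv_iff₀.2 ⟨he, he1⟩)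
    · rw [← Real.rpow_mul (by norm_num), inv_mul_cancel₀ he.ne', Real.rpow_one]
  have hR5 : 1 ≤ R ^ 5 := one_le_pow₀ (by linarith)
  refine ⟨72 * (11520000 * R ^ 5), by linarith, ?_⟩
  intro ι κ _ T P l z α β Kα Kβ δ hα0 hα2 hKα hKβ hδ hδ1 hT hP hz hclose hcard hβ hI
  set I := ∑ t ∈ T, ((P t).card : ℝ) with hIdef
  set X := T.biUnion P with hX
  set D := δ⁻¹ with hD
  have hD1 : 1 ≤ D := one_le_inv_iff₀.2 ⟨hδ, hδ1⟩
  have hDδ : D * δ = 1 := inv_mul_cancel₀ hδ.ne'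
  obtain ⟨S, hSR, hS⟩ : ∃ S, 2 * S = R ∧ 1 ≤ S := ⟨R / 2, by ring, by linarith⟩
  obtain ⟨n, hn, hn'⟩ := exists_scale_count (R := R) (by linarith) hδ hδ1
  have hpow4 : ∀ k ≤ n, (4 : ℝ) ^ k ≤ D ^ e := by
    intro k hk
    have h1 : R ^ k ≤ D := by
      refine (pow_le_pow_right₀ (by linarith) hk).trans ?_
      rw [hD, inv_eq_one_div, le_div_iff₀ hδ]; exact hn
    calc (4 : ℝ) ^ k = (R ^ k) ^ e := by
          rw [← hRe, ← Real.rpow_natCast, ← Real.rpow_natCast, ← Real.rpow_mul (by linarith),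
            ← Real.rpow_mul (by linarith), mul_comm]
      _ ≤ D ^ e := Real.rpow_le_rpow (by positivity) h1 he.le
  have hDe : 1 ≤ D ^ e := Real.one_le_rpow hD1 he.le
  have hn1 : (n : ℝ) + 1 ≤ D ^ e := by
    refine le_trans ?_ (hpow4 n le_rfl)
    have : n + 1 ≤ 4 ^ n := Nat.lt_pow_self (by norm_num)
    exact_mod_cast this
  have hsumI : ∑ p ∈ X, pointMult T P p = I := by
    rw [sum_pointMult]
    refine Finset.sum_congr rfl fun t ht => ?_
    congr 2
    ext p
    simp only [Finset.mem_filter, hX, Finset.mem_biUnion]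
    exact ⟨fun h => h.2, fun h => ⟨⟨t, ht, h⟩, h⟩⟩
  clear_value I
  have hX0 : (0 : ℝ) < X.card := by
    rw [Nat.cast_pos, Finset.card_pos]
    by_contra h
    rw [Finset.not_nonempty_iff_eq_empty] at h
    rw [h, Finset.sum_empty] at hsumI
    exact hI.ne hsumI
  obtain ⟨r, hIr⟩ : ∃ r : ℝ, I = 2 * X.card * r :=
    ⟨I / (2 * X.card), (mul_div_cancel₀ _ (by positivity)).symm⟩
  have hr0 : 0 < r := by
    rw [hIr] at hI
    exact pos_of_mul_pos_right hI (by positivity)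
  have hIX : I / 2 = X.card * r := by rw [hIr]; ring
  set X' := X.filter fun p => r ≤ pointMult T P p with hX'
  have hsumX' : I / 2 ≤ ∑ p ∈ X', pointMult T P p := by
    have h1 := Finset.sum_filter_add_sum_filter_not X (fun p => r ≤ pointMult T P p)
      (fun p => pointMult T P p)
    have h2 : ∑ p ∈ X.filter fun p => ¬ r ≤ pointMult T P p, pointMult T P p ≤ I / 2 := by
      calc _ ≤ ∑ p ∈ X.filter fun p => ¬ r ≤ pointMult T P p, r :=
            Finset.sum_le_sum fun p hp => (not_le.1 (Finset.mem_filter.1 hp).2).le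
        _ ≤ ∑ p ∈ X, r := Finset.sum_le_sum_of_subset_of_nonneg (Finset.filter_subset _ _)
            fun _ _ _ => hr0.le
        _ = I / 2 := by
            rw [Finset.sum_const, nsmul_eq_mul, hIX]
    linarith
  have hzX : ∀ p ∈ X, ‖z p‖ ≤ 1 := by
    intro p hp
    obtain ⟨t, ht, hpt⟩ := Finset.mem_biUnion.1 hp
    exact hz t ht p hpt
  choose K hKn hKcount hKhigh using fun p : κ =>
    exists_stopping_scale hT hS hδ (z p) n
  simp only [hSR] at hKcount hKhigh
  obtain ⟨k, hk, hIk⟩ : ∃ k ∈ Finset.range (n + 1),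
      I / 2 / (n + 1) ≤ ∑ p ∈ X'.filter fun p => K p = k, pointMult T P p := by
    refine Finset.exists_le_of_sum_le ⟨0, by simp⟩ ?_
    rw [Finset.sum_fiberwise_of_maps_to fun p _ => Finset.mem_range.2 (Nat.lt_succ_of_le (hKn p)),
      Finset.sum_const, Finset.card_range, nsmul_eq_mul]
    refine le_trans (le_of_eq ?_) hsumX'
    rw [Nat.cast_add_one, mul_div_cancel₀]
    positivity
  have hkn : k ≤ n := Nat.lt_succ_iff.1 (Finset.mem_range.1 hk)
  set A := X'.filter fun p => K p = k with hA
  set W := R ^ k with hW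
  set w := W * δ with hw
  have hW1 : 1 ≤ W := one_le_pow₀ (by linarith)
  have hW0 : 0 < W := by linarith
  have hδw : δ ≤ w := le_mul_of_one_le_left hδ.le hW1
  have hw0 : 0 < w := by positivity
  obtain ⟨Q, hQA, hQsep, hQnet⟩ := exists_maximal_separated A z hw0.le
  have hQX : ∀ q ∈ Q, q ∈ X := fun q hq =>
    (Finset.mem_filter.1 (Finset.mem_filter.1 (hQA hq)).1).1
  have hL2 := sum_lineCount_sq_le (k := k) hT hα0 hα2 hKα hδ hS hclose hcard hkn
    (by rw [hSR]; exact hn) (by rw [hSR]; exact hn') (fun q hq => hzX q (hQX q hq))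
    (by rw [hSR]; exact hQsep) (fun q hq => by
      have h := hKhigh q
      rw [(Finset.mem_filter.1 (hQA hq)).2] at h
      rw [hSR]; exact h)
  rw [hSR] at hL2
  set N := fun q => lineCount T l (4 * w) (z q) with hN
  have hNr : ∀ q ∈ Q, r * W ≤ D ^ e * N q := by
    intro q hq
    have hqA := Finset.mem_filter.1 (hQA hq)
    have h1 := hKcount q
    rw [hqA.2] at h1
    have h2 : r ≤ lineCount T l (4 * δ) (z q) := by
      refine (Finset.mem_filter.1 hqA.1).2.trans (pointMult_le_lineCount fun t ht hq' => ?_)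
      exact (hP t ht q hq').trans (by linarith)
    calc r * W = W * r := mul_comm _ _
      _ ≤ W * lineCount T l (4 * δ) (z q) := mul_le_mul_of_nonneg_left h2 hW0.le
      _ ≤ 4 ^ k * N q := h1
      _ ≤ D ^ e * N q := mul_le_mul_of_nonneg_right (hpow4 k hkn) (lineCount_nonneg _ _)
  have hnet := sum_pointMult_le (B := 9 * Kβ * W ^ β) hT hδw hP
    (fun t ht q => by
      have h := hβ t ht q w hδw
      rwa [hw, mul_div_cancel_right₀ _ hδ.ne'] at h) hQnet
  have hIN : I ≤ 2 * (n + 1) * (9 * Kβ * W ^ β * ∑ q ∈ Q, N q) := by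
    have h := hIk.trans hnet
    rw [div_div, div_le_iff₀ (by positivity)] at h
    linarith
  have hQne : Q.Nonempty := by
    by_contra h
    rw [Finset.not_nonempty_iff_eq_empty] at h
    rw [h, Finset.sum_empty, mul_zero, mul_zero] at hIN
    linarith
  have hsumN : r * W * ∑ q ∈ Q, N q ≤ D ^ e * ∑ q ∈ Q, N q ^ 2 := by
    rw [Finset.mul_sum, Finset.mul_sum]
    refine Finset.sum_le_sum fun q hq => ?_
    have := mul_le_mul_of_nonneg_right (hNr q hq) (lineCount_nonneg (T := T) (l := l) (4 * w) (z q))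
    calc _ ≤ D ^ e * N q * N q := this
      _ = _ := by ring
  refine ⟨W, hW1, ?_, ?_⟩
  · have h3e : D ^ (3 * e) = D ^ e * D ^ e * D ^ e := by
      rw [← Real.rpow_add (by linarith), ← Real.rpow_add (by linarith)]; ring_nf
    have hWab : W ^ (α + β) = W ^ α * W ^ β := Real.rpow_add hW0 _ _
    have hwD : W = D * w := by rw [hw, mul_left_comm, hDδ, mul_one]
    have h := sq_mul_sq_le_of_chain (b := Kβ) (c := W ^ β) hIr hwD hr0.le (by linarith) hw0.le hDe
      hX0.le (Nat.cast_nonneg T.card) (Nat.cast_nonneg n) (by positivity) (by linarith)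
      (by positivity) (by linarith) hn1 hIN hsumN hL2
    refine h.trans (le_of_eq ?_)
    rw [h3e, hWab]; ring
  · obtain ⟨q, hq⟩ := hQne
    have h1 := (hNr q hq).trans (mul_le_mul_of_nonneg_left (lineCount_le_card (T := T) _ _)
      (by positivity))
    calc I * W = 2 * X.card * (r * W) := by rw [hIr]; ring
      _ ≤ 2 * X.card * (D ^ e * T.card) := mul_le_mul_of_nonneg_left h1 (by positivity)
      _ = 2 * (D ^ e * X.card * T.card) := by ring
      _ ≤ 72 * (11520000 * R ^ 5) * (D ^ e * X.card * T.card) :=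
        mul_le_mul_of_nonneg_right (by linarith) (by positivity)
      _ = _ := by ring

/-- The coordinates of a point of the plane. -/
def planeCoords (y : Plane) : ℝ × ℝ := (y 0, y 1)

lemma plane_dist_sq (x y : Plane) : dist x y ^ 2 = (x 0 - y 0) ^ 2 + (x 1 - y 1) ^ 2 := by
  rw [EuclideanSpace.dist_eq, Real.sq_sqrt (by positivity), Fin.sum_univ_two,
    Real.dist_eq, Real.dist_eq, sq_abs, sq_abs]

lemma plane_norm_sq (u : Plane) : ‖u‖ ^ 2 = u 0 ^ 2 + u 1 ^ 2 := by
  rw [EuclideanSpace.norm_sq_eq, Fin.sum_univ_two, Real.norm_eq_abs, Real.norm_eq_abs, sq_abs,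
    sq_abs]

lemma norm_planeCoords_le_one {y : Plane} (hy : y ∈ unitSquare) : ‖planeCoords y‖ ≤ 1 := by
  rw [planeCoords, Prod.norm_def, max_le_iff, Real.norm_eq_abs, Real.norm_eq_abs,
    abs_of_nonneg (hy 0).1, abs_of_nonneg (hy 1).1]
  exact ⟨(hy 0).2, (hy 1).2⟩

lemma IsTube.exists_line {δ : ℝ} {t : Set Plane} (ht : IsTube δ t) :
    ∃ l : ℝ × ℝ × ℝ, l.1 ^ 2 + l.2.1 ^ 2 = 1 ∧ ∀ y ∈ t, |lineForm l (planeCoords y)| ≤ δ / 2 := by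
  obtain ⟨x, u, hu, rfl⟩ := ht
  have h := plane_norm_sq u
  refine ⟨(-u 1, u 0, u 0 * x 1 - u 1 * x 0), ?_, fun y hy => ?_⟩
  · rw [hu] at h
    linarith
  · have e : lineForm (-u 1, u 0, u 0 * x 1 - u 1 * x 0) (planeCoords y)
        = u 0 * (y 1 - x 1) - u 1 * (y 0 - x 0) := by
      simp only [lineForm, planeCoords]; ring
    rw [e]
    exact hy.2

/-- The part of the unit square near a line is contained in a rectangle of length two. -/
lemma exists_rectangle {l : ℝ × ℝ × ℝ} (hl : l.1 ^ 2 + l.2.1 ^ 2 = 1) (ρ : ℝ) :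
    ∃ R, IsRectangle ρ 2 R ∧
      ∀ y ∈ unitSquare, |lineForm l (planeCoords y)| ≤ ρ / 2 → y ∈ R := by
  obtain ⟨a, b, c⟩ := l
  simp only at hl
  set m := c - (a + b) / 2 with hm
  set u : Plane := !₂[b, -a] with hu
  set x : Plane := !₂[1 / 2 + m * a, 1 / 2 + m * b] with hx
  have hu0 : u 0 = b := rfl
  have hu1 : u 1 = -a := rfl
  have hx0 : x 0 = 1 / 2 + m * a := rfl
  have hx1 : x 1 = 1 / 2 + m * b := rfl
  refine ⟨_, ⟨x, u, ?_, rfl⟩, fun y hy hyl => ?_⟩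
  · have h := plane_norm_sq u
    rw [hu0, hu1] at h
    have h1 : ‖u‖ ^ 2 = 1 ^ 2 := by rw [h]; linarith
    exact (pow_left_inj₀ (norm_nonneg _) zero_le_one two_ne_zero).1 h1
  · constructor
    · have e : u 0 * (y 0 - x 0) + u 1 * (y 1 - x 1) = b * (y 0 - 1 / 2) - a * (y 1 - 1 / 2) := by
        rw [hu0, hu1, hx0, hx1]; ring
      rw [e]
      have h0 := hy 0
      have h1 := hy 1
      refine abs_le_of_sq_le_sq ?_ (by norm_num)
      have h2 : (y 0 - 1 / 2) ^ 2 ≤ 1 / 4 := by nlinarith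
      have h3 : (y 1 - 1 / 2) ^ 2 ≤ 1 / 4 := by nlinarith
      nlinarith [sq_nonneg (a * (y 0 - 1 / 2) + b * (y 1 - 1 / 2))]
    · have e : u 0 * (y 1 - x 1) - u 1 * (y 0 - x 0) = lineForm (a, b, c) (planeCoords y) := by
        rw [hu0, hu1, hx0, hx1]
        simp only [lineForm, planeCoords]
        have : m * (a ^ 2 + b ^ 2) = m := by rw [hl, mul_one]
        linear_combination -this - hm
      rw [e]
      exact hyl

/-- A tube whose line is close to `l` lies near `l`. -/
lemma abs_lineForm_le_of_closeLines {l l' : ℝ × ℝ × ℝ} (hl : l.1 ^ 2 + l.2.1 ^ 2 = 1)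
    (hl' : l'.1 ^ 2 + l'.2.1 ^ 2 = 1) {ρ : ℝ} (h : CloseLines ρ l l') {y : ℝ × ℝ}
    (hy : ‖y‖ ≤ 1) (hyl : |lineForm l' y| ≤ ρ / 2) : |lineForm l y| ≤ 12 * ρ := by
  obtain ⟨x, hx, h1, h2, h3⟩ := h
  have hρ : 0 ≤ ρ := (abs_nonneg _).trans h1
  set p := l.1 * l'.1 + l.2.1 * l'.2.1 with hp
  set d := l'.1 * (y.2 - x.2) - l'.2.1 * (y.1 - x.1) with hd
  have e : lineForm l y = lineForm l x + p * (lineForm l' y - lineForm l' x)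
      - formDet l l' * d := by
    simp only [lineForm, formDet, hp, hd]
    linear_combination (-(l.1 * (y.1 - x.1) + l.2.1 * (y.2 - x.2))) * hl'
  have hp1 : |p| ≤ 1 := by
    rw [abs_le_one_iff_mul_self_le_one]
    nlinarith [sq_nonneg (l.1 * l'.2.1 - l.2.1 * l'.1)]
  have hd1 : |d| ≤ 9 := by
    refine abs_le_of_sq_le_sq ?_ (by norm_num)
    have hn : ‖y - x‖ ≤ 6 := (norm_sub_le _ _).trans (by linarith)
    have hy1 : |y.1 - x.1| ≤ 6 := (norm_fst_le (y - x)).trans hn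
    have hy2 : |y.2 - x.2| ≤ 6 := (norm_snd_le (y - x)).trans hn
    have hq1 : (y.1 - x.1) ^ 2 ≤ 36 := by
      rw [← sq_abs]; nlinarith [abs_nonneg (y.1 - x.1)]
    have hq2 : (y.2 - x.2) ^ 2 ≤ 36 := by
      rw [← sq_abs]; nlinarith [abs_nonneg (y.2 - x.2)]
    have : d ^ 2 + (l'.1 * (y.1 - x.1) + l'.2.1 * (y.2 - x.2)) ^ 2
        = (y.1 - x.1) ^ 2 + (y.2 - x.2) ^ 2 := by
      rw [hd]
      linear_combination ((y.1 - x.1) ^ 2 + (y.2 - x.2) ^ 2) * hl'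
    nlinarith [sq_nonneg (l'.1 * (y.1 - x.1) + l'.2.1 * (y.2 - x.2))]
  have hA : |p * (lineForm l' y - lineForm l' x)| ≤ 1 * (ρ / 2 + ρ) := by
    rw [abs_mul]
    exact mul_le_mul hp1 ((abs_sub _ _).trans (by linarith)) (abs_nonneg _) zero_le_one
  have hB : |formDet l l' * d| ≤ ρ * 9 := by
    rw [abs_mul]
    exact mul_le_mul h3 hd1 (abs_nonneg _) hρ
  rw [e]
  have := abs_sub (lineForm l x + p * (lineForm l' y - lineForm l' x)) (formDet l l' * d)
  have := abs_add_le (lineForm l x) (p * (lineForm l' y - lineForm l' x))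
  linarith

open Classical in
lemma ncard_setOf_subset (F : Finset (Set Plane)) (B : Set Plane) :
    {s | s ∈ F ∧ s ⊆ B}.ncard = (F.filter fun s => s ⊆ B).card := by
  rw [← Set.ncard_coe_finset]
  congr 1
  ext s
  simp

lemma IsTubeSet.card_le_total {δ α K : ℝ} {T : Finset (Set Plane)} (hT : IsTubeSet δ α K T)
    (hδ1 : δ ≤ 1) : (T.card : ℝ) ≤ K * (1 / δ) ^ α := by
  classical
  obtain ⟨R, hR, hsub⟩ := exists_rectangle (l := (1, 0, 1 / 2)) (by norm_num) 1
  have h := hT.card_le 1 hδ1 le_rfl R hR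
  rw [ncard_setOf_subset, Finset.filter_true_of_mem] at h
  · exact h
  · intro t ht y hy
    have hyU := hT.subset_unitSquare t ht hy
    refine hsub y hyU ?_
    have h0 := hyU 0
    rw [lineForm, planeCoords, abs_le]
    constructor <;> dsimp only <;> linarith

lemma rpow_mul_le_sq {a x γ : ℝ} (ha : 1 ≤ a) (hx : 0 ≤ x) (hγ : γ ≤ 2) :
    (a * x) ^ γ ≤ a ^ 2 * x ^ γ := by
  rw [Real.mul_rpow (by linarith) hx, ← Real.rpow_natCast a 2]
  refine mul_le_mul_of_nonneg_right ?_ (by positivity)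
  exact Real.rpow_le_rpow_of_exponent_le ha (by exact_mod_cast hγ)

open Classical in
lemma IsTubeSet.card_closeLines_le {δ α K : ℝ} {T : Finset (Set Plane)}
    (hT : IsTubeSet δ α K T) (hα0 : 0 ≤ α) (hα2 : α ≤ 2) (hK : 1 ≤ K) (hδ : 0 < δ) (hδ1 : δ ≤ 1)
    {l : Set Plane → ℝ × ℝ × ℝ} (hl : ∀ t ∈ T, (l t).1 ^ 2 + (l t).2.1 ^ 2 = 1)
    (hl' : ∀ t ∈ T, ∀ y ∈ t, |lineForm (l t) (planeCoords y)| ≤ δ / 2)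
    {t : Set Plane} (ht : t ∈ T) {ρ : ℝ} (hρ : δ ≤ ρ) :
    ((T.filter fun s => CloseLines ρ (l t) (l s)).card : ℝ) ≤ 576 * K * (ρ / δ) ^ α := by
  have hρ0 : 0 < ρ := hδ.trans_le hρ
  have hfin : K * (24 * (ρ / δ)) ^ α ≤ 576 * K * (ρ / δ) ^ α := by
    have := mul_le_mul_of_nonneg_left
      (rpow_mul_le_sq (a := 24) (x := ρ / δ) (by norm_num) (by positivity) hα2)
      (by linarith : 0 ≤ K)
    linarith
  refine le_trans ?_ hfin
  rcases le_total (24 * ρ) 1 with h | h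
  · obtain ⟨R, hR, hsub⟩ := exists_rectangle (hl t ht) (24 * ρ)
    have hc := hT.card_le (24 * ρ) (by linarith) h R hR
    rw [ncard_setOf_subset, mul_div_assoc] at hc
    refine le_trans ?_ hc
    norm_cast
    refine Finset.card_le_card fun s hs => ?_
    rw [Finset.mem_filter] at hs ⊢
    refine ⟨hs.1, fun y hy => ?_⟩
    have hyU := hT.subset_unitSquare s hs.1 hy
    refine hsub y hyU ?_
    have := abs_lineForm_le_of_closeLines (hl t ht) (hl s hs.1) hs.2
      (norm_planeCoords_le_one hyU) ((hl' s hs.1 y hy).trans (by linarith))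
    linarith
  · refine le_trans ?_ ((hT.card_le_total hδ1).trans ?_)
    · exact_mod_cast Finset.card_filter_le _ _
    · refine mul_le_mul_of_nonneg_left (Real.rpow_le_rpow (by positivity) ?_ hα0) (by linarith)
      rw [← mul_div_assoc]
      exact div_le_div_of_nonneg_right h hδ.le

open Classical in
lemma IsBallSet.card_near_le {δ β K : ℝ} {P : Finset (Set Plane)} (hP : IsBallSet δ β K P)
    (hβ0 : 0 ≤ β) (hβ2 : β ≤ 2) (hK : 1 ≤ K) (hδ : 0 < δ) (hδ1 : δ ≤ 1) {z : Set Plane → Plane}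
    (hz : ∀ p ∈ P, p = Metric.closedBall (z p) δ) (q : ℝ × ℝ) {w : ℝ} (hw : δ ≤ w) :
    ((P.filter fun p => ‖planeCoords (z p) - q‖ ≤ w).card : ℝ) ≤ 9 * K * (w / δ) ^ β := by
  have hw0 : 0 < w := hδ.trans_le hw
  have hfin : K * (3 * (w / δ)) ^ β ≤ 9 * K * (w / δ) ^ β := by
    have := mul_le_mul_of_nonneg_left
      (rpow_mul_le_sq (a := 3) (x := w / δ) (by norm_num) (by positivity) hβ2)
      (by linarith : 0 ≤ K)
    linarith
  refine le_trans ?_ hfin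
  rcases le_total (3 * w) 1 with h | h
  · have hc := hP.card_le (3 * w) (by linarith) h _ ⟨!₂[q.1, q.2], rfl⟩
    rw [ncard_setOf_subset, mul_div_assoc] at hc
    refine le_trans ?_ hc
    norm_cast
    refine Finset.card_le_card fun p hp => ?_
    rw [Finset.mem_filter] at hp ⊢
    refine ⟨hp.1, ?_⟩
    rw [hz p hp.1]
    refine Metric.closedBall_subset_closedBall' ?_
    have hd : dist (z p) !₂[q.1, q.2] ≤ 2 * w := by
      refine abs_le_of_sq_le_sq' ?_ (by positivity) |>.2
      rw [plane_dist_sq]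
      have h1 : |z p 0 - q.1| ≤ w := (norm_fst_le (planeCoords (z p) - q)).trans hp.2
      have h2 : |z p 1 - q.2| ≤ w := (norm_snd_le (planeCoords (z p) - q)).trans hp.2
      change (z p 0 - q.1) ^ 2 + (z p 1 - q.2) ^ 2 ≤ (2 * w) ^ 2
      rw [← sq_abs (z p 0 - q.1), ← sq_abs (z p 1 - q.2)]
      nlinarith [abs_nonneg (z p 0 - q.1), abs_nonneg (z p 1 - q.2)]
    linarith
  · have hc := hP.card_le 1 hδ1 le_rfl _ ⟨!₂[1 / 2, 1 / 2], rfl⟩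
    rw [ncard_setOf_subset, Finset.filter_true_of_mem] at hc
    · refine le_trans ?_ (hc.trans ?_)
      · exact_mod_cast Finset.card_filter_le _ _
      · refine mul_le_mul_of_nonneg_left (Real.rpow_le_rpow (by positivity) ?_ hβ0) (by linarith)
        rw [← mul_div_assoc]
        exact div_le_div_of_nonneg_right h hδ.le
    · intro p hp y hy
      have hyU := hP.subset_unitSquare p hp hy
      rw [Metric.mem_closedBall]
      refine abs_le_of_sq_le_sq' ?_ zero_le_one |>.2
      rw [plane_dist_sq]
      have h0 := hyU 0
      have h1 := hyU 1
      change (y 0 - 1 / 2) ^ 2 + (y 1 - 1 / 2) ^ 2 ≤ 1 ^ 2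
      nlinarith

lemma abs_lineForm_center_le {δ : ℝ} (hδ : 0 < δ) {l : ℝ × ℝ × ℝ}
    (hl : l.1 ^ 2 + l.2.1 ^ 2 = 1) {x y : Plane} (hxy : dist x y ≤ δ)
    (hy : |lineForm l (planeCoords y)| ≤ δ / 2) : |lineForm l (planeCoords x)| ≤ 2 * δ := by
  have hd : |lineForm l (planeCoords x) - lineForm l (planeCoords y)| ≤ δ := by
    refine abs_le_of_sq_le_sq ?_ hδ.le
    have h1 : dist x y ^ 2 ≤ δ ^ 2 := pow_le_pow_left₀ dist_nonneg hxy 2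
    rw [plane_dist_sq] at h1
    refine le_trans ?_ h1
    have e : lineForm l (planeCoords x) - lineForm l (planeCoords y)
        = l.1 * (x 0 - y 0) + l.2.1 * (x 1 - y 1) := by
      simp only [lineForm, planeCoords]; ring
    rw [e]
    have : (l.1 * (x 0 - y 0) + l.2.1 * (x 1 - y 1)) ^ 2
        + (l.1 * (x 1 - y 1) - l.2.1 * (x 0 - y 0)) ^ 2 = (x 0 - y 0) ^ 2 + (x 1 - y 1) ^ 2 := by
      linear_combination ((x 0 - y 0) ^ 2 + (x 1 - y 1) ^ 2) * hl
    nlinarith [sq_nonneg (l.1 * (x 1 - y 1) - l.2.1 * (x 0 - y 0))]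
  have := abs_sub_abs_le_abs_sub (lineForm l (planeCoords x)) (lineForm l (planeCoords y))
  linarith

/-- Eliminating the stopping scale from the two incidence bounds. -/
lemma le_rpow_of_scale_bounds {I W A B Y γ m : ℝ} (hI : 0 < I) (hW : 1 ≤ W) (hA : 0 ≤ A)
    (hB : 1 ≤ B) (hY : 0 < Y) (hγm : γ ≤ m) (hm2 : 2 ≤ m) (hm4 : m ≤ 4)
    (h1 : I ^ 2 * W ^ 2 ≤ A * Y * W ^ γ) (h2 : I * W ≤ B * Y) :
    I ^ m ≤ A * B ^ 2 * Y ^ (m - 1) := by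
  have hW0 : 0 < W := by linarith
  have hB0 : 0 < B := by linarith
  have e1 : W ^ m = W ^ (m - 2) * W ^ 2 := by
    rw [← Real.rpow_natCast W 2, ← Real.rpow_add hW0]; norm_num
  have e2 : I ^ m = I ^ 2 * I ^ (m - 2) := by
    rw [← Real.rpow_natCast I 2, ← Real.rpow_add hI]; norm_num
  have e3 : Y ^ (m - 1) = Y * Y ^ (m - 2) := by
    nth_rewrite 2 [← Real.rpow_one Y]
    rw [← Real.rpow_add hY]; ring_nf
  have h3 : I ^ 2 ≤ A * Y * W ^ (m - 2) := by
    have h := h1.trans (mul_le_mul_of_nonneg_left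
      (Real.rpow_le_rpow_of_exponent_le hW hγm) (by positivity))
    rw [e1, ← mul_assoc] at h
    exact le_of_mul_le_mul_right h (by positivity)
  calc I ^ m ≤ A * Y * W ^ (m - 2) * I ^ (m - 2) := by
        rw [e2]; exact mul_le_mul_of_nonneg_right h3 (by positivity)
    _ = A * Y * (I * W) ^ (m - 2) := by rw [Real.mul_rpow hI.le hW0.le]; ring
    _ ≤ A * Y * (B * Y) ^ (m - 2) :=
        mul_le_mul_of_nonneg_left (Real.rpow_le_rpow (by positivity) h2 (by linarith))
          (by positivity)
    _ = A * Y * (B ^ (m - 2) * Y ^ (m - 2)) := by rw [Real.mul_rpow hB0.le hY.le]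
    _ ≤ A * Y * (B ^ 2 * Y ^ (m - 2)) := by
        refine mul_le_mul_of_nonneg_left (mul_le_mul_of_nonneg_right ?_ (by positivity))
          (by positivity)
        rw [← Real.rpow_natCast B 2]
        exact Real.rpow_le_rpow_of_exponent_le hB (by push_cast; linarith)
    _ = A * B ^ 2 * Y ^ (m - 1) := by rw [e3]; ring

lemma le_of_rpow_le {I C D ε e Ka Kb x τ m : ℝ} (hI : 0 < I) (hC : 1 ≤ C) (hD : 1 ≤ D)
    (hKa : 1 ≤ Ka) (hKb : 1 ≤ Kb) (hx : 0 < x) (hτ : 0 < τ) (hm2 : 2 ≤ m) (he : 0 ≤ e)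
    (heε : 5 * e ≤ ε)
    (h : I ^ m ≤ (C * D ^ (3 * e) * (Ka * Kb) * D) * (C * D ^ e) ^ 2 * (x * τ) ^ (m - 1)) :
    I ≤ C ^ 3 * D ^ (m⁻¹ + ε) * Kb ^ m⁻¹ * Ka ^ m⁻¹ * x ^ (1 - m⁻¹) * τ ^ (1 - m⁻¹) := by
  have hm0 : 0 < m := by linarith
  have hD0 : 0 < D := by linarith
  have hC0 : 0 < C := by linarith
  have hc0 : 0 ≤ m⁻¹ := by positivity
  have hc1 : m⁻¹ ≤ 1 := inv_le_one_of_one_le₀ (by linarith)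
  have e5 : D ^ (5 * e) = D ^ (3 * e) * (D ^ e) ^ 2 := by
    rw [← Real.rpow_natCast (D ^ e) 2, ← Real.rpow_mul hD0.le, ← Real.rpow_add hD0]
    push_cast; ring_nf
  have h' : I ^ m ≤ C ^ 3 * D ^ (5 * e) * D * Kb * Ka * (x ^ (m - 1) * τ ^ (m - 1)) := by
    rw [Real.mul_rpow hx.le hτ.le] at h
    refine h.trans (le_of_eq ?_)
    rw [e5]; ring
  have hpow := Real.rpow_le_rpow (by positivity) h' hc0
  rw [← Real.rpow_mul hI.le, mul_inv_cancel₀ hm0.ne', Real.rpow_one] at hpow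
  refine hpow.trans ?_
  have ex : ∀ y : ℝ, 0 < y → (y ^ (m - 1)) ^ m⁻¹ = y ^ (1 - m⁻¹) := by
    intro y hy
    rw [← Real.rpow_mul hy.le, sub_mul, mul_inv_cancel₀ hm0.ne', one_mul]
  rw [Real.mul_rpow (by positivity) (by positivity), Real.mul_rpow (by positivity) (by linarith),
    Real.mul_rpow (by positivity) (by linarith), Real.mul_rpow (by positivity) hD0.le,
    Real.mul_rpow (by positivity) (by positivity), Real.mul_rpow (by positivity) (by positivity),
    ex x hx, ex τ hτ, Real.rpow_add hD0, ← mul_assoc]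
  have hC3 : (C ^ 3) ^ m⁻¹ ≤ C ^ 3 := by
    have h := Real.rpow_le_rpow_of_exponent_le (one_le_pow₀ hC : 1 ≤ C ^ 3) hc1
    rwa [Real.rpow_one] at h
  have hDe : (D ^ (5 * e)) ^ m⁻¹ ≤ D ^ ε := by
    rw [← Real.rpow_mul hD0.le]
    refine Real.rpow_le_rpow_of_exponent_le hD ?_
    nlinarith
  calc (C ^ 3) ^ m⁻¹ * (D ^ (5 * e)) ^ m⁻¹ * D ^ m⁻¹ * Kb ^ m⁻¹ * Ka ^ m⁻¹ * x ^ (1 - m⁻¹)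
        * τ ^ (1 - m⁻¹)
      ≤ C ^ 3 * D ^ ε * D ^ m⁻¹ * Kb ^ m⁻¹ * Ka ^ m⁻¹ * x ^ (1 - m⁻¹) * τ ^ (1 - m⁻¹) := by
        gcongr
    _ = _ := by ring

theorem theorem5p2 (ε : ℝ) (hε : 0 < ε) :
    ∃ C : ℝ, 0 < C ∧
      ∀ (α β Kα Kβ δ : ℝ), 0 ≤ α → α ≤ 2 → 0 ≤ β → β ≤ 2 → 1 ≤ Kα → 1 ≤ Kβ → 0 < δ → δ ≤ 1 →
      ∀ (T : Finset (Set Plane)) (P : Set Plane → Finset (Set Plane)),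
        IsTubeSet δ α Kα T →
        (∀ t ∈ T, IsBallSet δ β Kβ (P t) ∧ ∀ p ∈ P t, (p ∩ t).Nonempty) →
        ∀ c : ℝ, c = (max (α + β) 2)⁻¹ →
          ∑ t ∈ T, ((P t).card : ℝ) ≤
            C * (δ⁻¹) ^ (c + ε) * Kβ ^ c * Kα ^ c *
              ((⋃ t ∈ T, (P t : Set (Set Plane))).ncard : ℝ) ^ (1 - c) *
              (T.card : ℝ) ^ (1 - c) := by
  classical
  obtain ⟨e, he, he1, heε⟩ : ∃ e : ℝ, 0 < e ∧ e ≤ 1 ∧ 5 * e ≤ ε :=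
    ⟨min 1 (ε / 5), by positivity, min_le_left _ _, by linarith [min_le_right 1 (ε / 5)]⟩
  obtain ⟨C, hC, hmain⟩ := exists_scale_incidence_bounds he he1
  refine ⟨C ^ 3, by positivity, ?_⟩
  intro α β Kα Kβ δ hα0 hα2 hβ0 hβ2 hKα hKβ hδ hδ1 T P hT hP c hc
  have hunion : (⋃ t ∈ T, (P t : Set (Set Plane))).ncard = (T.biUnion P).card := by
    rw [← Set.ncard_coe_finset, Finset.coe_biUnion]
    rfl
  rw [hunion]
  rcases (Finset.sum_nonneg fun t _ => Nat.cast_nonneg (P t).card :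
    (0 : ℝ) ≤ ∑ t ∈ T, ((P t).card : ℝ)).eq_or_lt with h0 | hI
  · rw [← h0]
    positivity
  choose! l hl hl' using fun t (ht : t ∈ T) => (hT.isTube t ht).exists_line
  have hcent : ∀ p : Set Plane, ∃ x : Plane, IsBallOfRadius δ p → p = Metric.closedBall x δ := by
    intro p
    by_cases h : IsBallOfRadius δ p
    · exact h.imp fun x hx _ => hx
    · exact ⟨0, fun h' => absurd h' h⟩
  choose z hz using hcent
  have hzP : ∀ t ∈ T, ∀ p ∈ P t, p = Metric.closedBall (z p) δ := fun t ht p hp =>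
    hz p ((hP t ht).1.isBall p hp)
  have hD1 : 1 ≤ δ⁻¹ := one_le_inv_iff₀.2 ⟨hδ, hδ1⟩
  obtain ⟨W, hW, h1, h2⟩ := hmain (z := fun p => planeCoords (z p)) (β := β) hα0 hα2 hKα hKβ hδ
    hδ1 hl
    (fun t ht p hp => by
      obtain ⟨y, hyp, hyt⟩ := (hP t ht).2 p hp
      rw [hzP t ht p hp, Metric.mem_closedBall, dist_comm] at hyp
      exact abs_lineForm_center_le hδ (hl t ht) hyp (hl' t ht y hyt))
    (fun t ht p hp => by
      have hmem : z p ∈ Metric.closedBall (z p) δ := Metric.mem_closedBall_self hδ.le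
      rw [← hzP t ht p hp] at hmem
      exact norm_planeCoords_le_one ((hP t ht).1.subset_unitSquare p hp hmem))
    (fun t ht ρ hρ => hT.card_closeLines_le hα0 hα2 hKα hδ hδ1 hl hl' ht hρ)
    (hT.card_le_total hδ1)
    (fun t ht q w hw => (hP t ht).1.card_near_le hβ0 hβ2 hKβ hδ hδ1 (hzP t ht) q hw)
    hI
  have hT0 : (0 : ℝ) < T.card := by
    rw [Nat.cast_pos, Finset.card_pos]
    by_contra h
    rw [Finset.not_nonempty_iff_eq_empty.1 h] at hI
    simp at hI
  have hX0 : (0 : ℝ) < (T.biUnion P).card := by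
    rw [Nat.cast_pos, Finset.card_pos]
    by_contra h
    rw [Finset.not_nonempty_iff_eq_empty] at h
    rw [h] at h2
    simp only [Finset.card_empty, Nat.cast_zero, mul_zero, zero_mul] at h2
    nlinarith
  rw [hc]
  refine le_of_rpow_le hI hC hD1 hKα hKβ hX0 hT0 (le_max_right _ _) he.le heε ?_
  refine le_rpow_of_scale_bounds (γ := α + β) hI hW (by positivity)
    (one_le_mul_of_one_le_of_one_le hC (Real.one_le_rpow hD1 he.le)) (by positivity)
    (le_max_left _ _) (le_max_right _ _) (max_le (by linarith) (by norm_num)) ?_ ?_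
  · exact h1.trans (le_of_eq (by ring))
  · exact h2.trans (le_of_eq (by ring))
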